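/- Consider the following problem, the $(B^+,\delta^-\ge 1)$-$[k_1,k_2]$-partition problem. An instance consists of a finite digraph $D=(V,A)$ without loops and parallel arcs and of natural numbers $k_1,k_2\ge 0$. The question is whether $V$ has a partition into two disjoint sets $V_1,V_2$ with $|V_1|\ge k_1$ and $|V_2|\ge k_2$ such that the induced subdigraph $D[V_1]$ has an out-branching and the induced subdigraph $D[V_2]$ has minimum in-degree at least $1$. Here an out-branching of a digraph $H$ is a spanning subdigraph $T$ of $H$ whose underlying graph is connected and which has a vertex $s$ (the root) of in-degree $0$ in $T$, while every other vertex has in-degree exactly $1$ in $T$; in particular $V_1$ is non-empty. The set $V_2$ may be empty (if $k_2=0$). **Theorem.** This problem is fixed-parameter tractable with respect to the parameter $k=\max(k_1,k_2)$: there are an algorithm (a program of a random access machine with unit-cost addition, subtraction and indirect addressing), a computable function $f:\mathbb N\to\mathbb N$ and a constant $c$ such that the algorithm decides every instance of size $N$ and parameter $k$ in time at most $f(k)\cdot (N+1)^c$. Here $N$ is the length of the word that encodes the instance, namely $k_1$ and $k_2$ in binary and the adjacency matrix of $D$. -/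

import Mathlib

/-! ## A random access machine

Programs are while-programs over finitely many registers and finitely many arrays of natural
numbers with indirect addressing. The arithmetic operations are addition and truncated
subtraction; every elementary operation costs one unit. (There is no multiplication, so running
times are polynomially related to those of Turing machines.) -/

namespace RAM

/-- Contents of the memory: `reg x` is the content of register `x`, and `arr a i` is the content
of cell `i` of array `a`. -/
structure State where
  reg : ℕ → ℕ
  arr : ℕ → ℕ → ℕ

/-- Expressions: constants, registers, array access, sum, truncated difference. -/
inductive Expr where
  | lit (c : ℕ)
  | reg (x : ℕ)
  | get (a : ℕ) (i : Expr)
  | add (e₁ e₂ : Expr)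
  | sub (e₁ e₂ : Expr)

/-- The value of an expression in a state. -/
def Expr.eval (s : State) : Expr → ℕ
  | lit c => c
  | reg x => s.reg x
  | get a i => s.arr a (i.eval s)
  | add e₁ e₂ => e₁.eval s + e₂.eval s
  | sub e₁ e₂ => e₁.eval s - e₂.eval s

/-- The time needed to evaluate an expression: one unit for each operation in it. -/
def Expr.cost : Expr → ℕ
  | lit _ => 1
  | reg _ => 1
  | get _ i => i.cost + 1
  | add e₁ e₂ => e₁.cost + e₂.cost + 1
  | sub e₁ e₂ => e₁.cost + e₂.cost + 1

/-- Programs. The tests of conditionals and loops succeed when the value is nonzero. -/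
inductive Prog where
  | skip
  | assign (x : ℕ) (e : Expr)
  | store (a : ℕ) (i e : Expr)
  | seq (p q : Prog)
  | cond (e : Expr) (p q : Prog)
  | loop (e : Expr) (p : Prog)

/-- `Exec p s s' t`: the program `p`, started in the state `s`, halts in the state `s'` after
exactly `t` units of time. -/
inductive Exec : Prog → State → State → ℕ → Prop
  | skip (s : State) : Exec .skip s s 1
  | assign (x : ℕ) (e : Expr) (s : State) :
      Exec (.assign x e) s ⟨Function.update s.reg x (e.eval s), s.arr⟩ (e.cost + 1)
  | store (a : ℕ) (i e : Expr) (s : State) :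
      Exec (.store a i e) s
        ⟨s.reg, Function.update s.arr a (Function.update (s.arr a) (i.eval s) (e.eval s))⟩
        (i.cost + e.cost + 1)
  | seq {p q : Prog} {s₁ s₂ s₃ : State} {t₁ t₂ : ℕ} :
      Exec p s₁ s₂ t₁ → Exec q s₂ s₃ t₂ → Exec (.seq p q) s₁ s₃ (t₁ + t₂)
  | condTrue {e : Expr} {p q : Prog} {s s₁ : State} {t : ℕ} :
      e.eval s ≠ 0 → Exec p s s₁ t → Exec (.cond e p q) s s₁ (e.cost + t + 1)
  | condFalse {e : Expr} {p q : Prog} {s s₁ : State} {t : ℕ} :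
      e.eval s = 0 → Exec q s s₁ t → Exec (.cond e p q) s s₁ (e.cost + t + 1)
  | loopStep {e : Expr} {p : Prog} {s s₁ s₂ : State} {t₁ t₂ : ℕ} :
      e.eval s ≠ 0 → Exec p s s₁ t₁ → Exec (.loop e p) s₁ s₂ t₂ →
        Exec (.loop e p) s s₂ (e.cost + t₁ + t₂ + 1)
  | loopDone {e : Expr} {p : Prog} {s : State} :
      e.eval s = 0 → Exec (.loop e p) s s (e.cost + 1)

/-- The initial state on an input word over the finite alphabet `{0, …, b - 1}`: the word is in
array `0`, its length is in register `0`, and everything else is zero. -/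
def init {b : ℕ} (w : List (Fin b)) : State where
  reg x := if x = 0 then w.length else 0
  arr a i := if a = 0 then (w.map Fin.val).getD i 0 else 0

end RAM

/-- The decision problem `yes` on instances of type `α`, presented as words over a finite alphabet
by `enc`, is fixed-parameter tractable with respect to the parameter `param`: a single program
decides every instance of size `n` and parameter `k` in time at most `f k * (n + 1) ^ c`, where
`f` is a computable function and `c` is a constant. The answer is yes if register `0` is nonzero
when the program halts. -/
def FixedParameterTractable {α : Type} {b : ℕ} (enc : α → List (Fin b)) (param : α → ℕ)
    (yes : α → Prop) : Prop :=
  ∃ (p : RAM.Prog) (f : ℕ → ℕ) (c : ℕ), Computable f ∧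
    ∀ x : α, ∃ (s : RAM.State) (t : ℕ),
      RAM.Exec p (RAM.init (enc x)) s t ∧
      t ≤ f (param x) * ((enc x).length + 1) ^ c ∧
      (s.reg 0 ≠ 0 ↔ yes x)

/-! ## Digraphs -/

namespace Digraph

variable {V : Type*}

/-- The subdigraph induced by a set of vertices. -/
def inducedOn (D : Digraph V) (U : Set V) : Digraph U where
  Adj u v := D.Adj u v

/-- The in-degree of a vertex. -/
noncomputable def inDegree (D : Digraph V) (v : V) : ℕ := {u | D.Adj u v}.ncard

/-- `T` is an out-tree rooted in `s`: its underlying graph is connected, the root has in-degree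
`0`, and every other vertex has in-degree `1`. -/
def IsOutTree (T : Digraph V) (s : V) : Prop :=
  T.toSimpleGraphInclusive.Connected ∧ T.inDegree s = 0 ∧ ∀ u, u ≠ s → T.inDegree u = 1

/-- `D` has an out-branching, i.e. a spanning subdigraph that is an out-tree. -/
def HasOutBranching (D : Digraph V) : Prop :=
  ∃ T : Digraph V, T ≤ D ∧ ∃ s : V, T.IsOutTree s

/-- The minimum in-degree of `D` is at least `d`. -/
def MinInDegreeAtLeast (D : Digraph V) (d : ℕ) : Prop := ∀ v : V, d ≤ D.inDegree v

end Digraph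

/-- An instance: a finite digraph without loops, on the vertex set `{0, …, n - 1}`, and two natural
numbers. -/
structure PartitionInput where
  n : ℕ
  D : Digraph (Fin n)
  loopless : ∀ v, ¬ D.Adj v v
  k₁ : ℕ
  k₂ : ℕ

namespace PartitionInput

/-- The vertex set has a partition into `V₁` and `V₂` such that the digraph induced by `V₁` has an
out-branching, the digraph induced by `V₂` has minimum in-degree at least `1`, and `|Vᵢ| ≥ kᵢ`. -/
def HasPartition (I : PartitionInput) : Prop :=
  ∃ V₁ V₂ : Finset (Fin I.n), Disjoint V₁ V₂ ∧ V₁ ∪ V₂ = Finset.univ ∧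
    (I.D.inducedOn (V₁ : Set (Fin I.n))).HasOutBranching ∧
    (I.D.inducedOn (V₂ : Set (Fin I.n))).MinInDegreeAtLeast 1 ∧
    I.k₁ ≤ V₁.card ∧ I.k₂ ≤ V₂.card

/-- The parameter `max (k₁, k₂)`. -/
def param (I : PartitionInput) : ℕ := max I.k₁ I.k₂

/-- A binary digit as a letter of the alphabet `{0, 1, 2}`; the letter `2` is used as an end
marker. -/
def letter (d : Bool) : Fin 3 := if d then 1 else 0

open Classical in
/-- The input word of an instance: `k₁` and `k₂` in binary (least significant digit first),
followed by the rows of the adjacency matrix of the digraph, each of these followed by an end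
marker. -/
noncomputable def encode (I : PartitionInput) : List (Fin 3) :=
  (Nat.bits I.k₁).map letter ++ [2] ++ ((Nat.bits I.k₂).map letter ++ [2]) ++
    (List.finRange I.n).flatMap fun u =>
      ((List.finRange I.n).map fun v => letter (decide (I.D.Adj u v))) ++ [2]

end PartitionInput

/-! A partition exists iff there is a root `s`, all other vertices having in-neighbours in `D`, and
a tree `Y` grown from `s` with at least `k₁` vertices that spares a disjoint source-free set `W`
with at least `k₂` vertices (`hasPartition_iff`). Given these, enlarge `Y` to a maximal tree
avoiding `W`; a vertex outside both has an in-neighbour, which by maximality is not in the tree, so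
the complement of the tree is source-free.

It remains to search for `Y`, adding one vertex at a time and keeping only trees that spare `k₂`
vertices. Sparing is tested in polynomial time by deleting sources repeatedly. The depth of the
search is at most `k₁`; its degree is bounded by `exists_subset_spares`: with `K = m + q`, among
`2K² + 2K + 1` vertices each of which can be spared alone, some `m` can be spared together. Hence,
for `m = k₁` and `q = k₂`, any that many candidate children include one that leads to success, and
the other children may be ignored (`Extends.exists_insert`).

To prove the lemma, let `W` be a smallest source-free set avoiding the tree with at least `q`
vertices. Either `m` of the given vertices lie outside `W`, or `W` is large and minimality makes it
a single directed cycle. A source-free set avoiding a vertex `b` of the cycle is either disjoint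
from the cycle, which ends the proof at once, or provides a detour that bypasses a segment around
`b`. A detour bypassing `m + q` of the given vertices allows `m` of them to be given up and `q`
kept. If all detours are shorter, those around `K` well-spaced vertices do not overlap and can be
used simultaneously.

The machine runs the search with an explicit stack. Apart from the main loop its programs have
bounded iterations only, so that their cost can be read off the syntax (`exec_compile`); the main
loop is controlled by the potential `work`, which limits the number of trees processed to `n` times
a function of the parameter. -/

/-! ## Sets without sources and trees grown from a root -/

namespace Digraph

variable {V : Type*}

/-- Every vertex of `W` has an in-neighbour in `W`. -/
def InClosed (D : Digraph V) (W : Finset V) : Prop := ∀ v ∈ W, ∃ u ∈ W, D.Adj u v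

/-- Some set of at least `q` vertices avoids `X` and induces a digraph of minimum in-degree at
least `1`. -/
def Spares (D : Digraph V) (q : ℕ) (X : Finset V) : Prop :=
  ∃ W : Finset V, Disjoint W X ∧ D.InClosed W ∧ q ≤ W.card

/-- `X` is the vertex set of an out-tree rooted in `s`: it arises from `{s}` by repeatedly adding
out-neighbours. -/
inductive Grown [DecidableEq V] (D : Digraph V) (s : V) : Finset V → Prop
  | root : Grown D s {s}
  | grow {X : Finset V} {x u : V} : Grown D s X → u ∉ X → x ∈ X → D.Adj x u →
      Grown D s (insert u X)

variable {D : Digraph V} {s : V} {q : ℕ} {X Y : Finset V}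

theorem Spares.mono (h : D.Spares q Y) (hXY : X ⊆ Y) : D.Spares q X := by
  obtain ⟨W, h1, h2, h3⟩ := h
  exact ⟨W, Finset.disjoint_of_subset_right hXY h1, h2, h3⟩

variable [DecidableEq V]

theorem Grown.root_mem (h : D.Grown s X) : s ∈ X := by
  induction h with
  | root => simp
  | grow _ _ _ _ ih => exact Finset.mem_insert_of_mem ih

/-- Among the vertices of `Y` missing from `X`, the one added first has its in-neighbour in `X`. So
a target tree can be approached from any partial tree, whatever the order in which either was grown.
-/
theorem Grown.exists_adj (h : D.Grown s Y) :
    ∀ {X : Finset V}, s ∈ X → X ⊆ Y → X ≠ Y → ∃ u ∈ Y, u ∉ X ∧ ∃ x ∈ X, D.Adj x u := by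
  induction h with
  | root =>
    intro X hs hX hne
    exact absurd (Finset.Subset.antisymm hX (by simpa using hs)) hne
  | @grow Y x u hY hu hx hxu ih =>
    intro X hs hX hne
    by_cases hYX : Y ⊆ X
    · refine ⟨u, by simp, fun huX => hne (Finset.Subset.antisymm hX ?_), x, hYX hx, hxu⟩
      exact Finset.insert_subset huX hYX
    · obtain ⟨v, hv, hvX, y, hy, hyv⟩ := ih (X := X ∩ Y)
        (Finset.mem_inter.2 ⟨hs, hY.root_mem⟩) Finset.inter_subset_right
        (fun h => hYX (Finset.inter_eq_right.1 h))
      refine ⟨v, Finset.mem_insert_of_mem hv, fun h => hvX (Finset.mem_inter.2 ⟨h, hv⟩), y,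
        (Finset.mem_inter.1 hy).1, hyv⟩

theorem Grown.union (h : D.Grown s X) (S : Finset V) (hS : ∀ u ∈ S, ∃ x ∈ X, D.Adj x u) :
    D.Grown s (X ∪ S) := by
  induction S using Finset.induction_on with
  | empty => simpa
  | insert a S ha ih =>
    have ih := ih fun u hu => hS u (Finset.mem_insert_of_mem hu)
    rw [Finset.union_insert]
    by_cases h' : a ∈ X ∪ S
    · rwa [Finset.insert_eq_of_mem h']
    · obtain ⟨x, hx, hxa⟩ := hS a (Finset.mem_insert_self _ _)
      exact ih.grow h' (Finset.mem_union_left _ hx) hxa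

/-! ### A cycle of minimal size -/

/-- `e` runs backwards through a cycle of length `L` with vertex set `W`. -/
structure IsBackwardCycle (D : Digraph V) (W : Finset V) (e : ℕ → V) (L : ℕ) : Prop where
  pos : 0 < L
  adj : ∀ i, D.Adj (e (i + 1)) (e i)
  period : ∀ i, e (i + L) = e i
  inj : ∀ a i j, a ≤ i → a ≤ j → i < a + L → j < a + L → e i = e j → i = j
  mem : ∀ i, e i ∈ W
  surj : ∀ a, ∀ v ∈ W, ∃ i, a ≤ i ∧ i < a + L ∧ e i = v

/-- Choose an in-neighbour `p v` in `W` for each `v`. A vertex missed by `p` could be deleted, so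
`p` permutes `W`. An orbit and its complement are both source-free, and one of them has at least `q`
vertices; minimality leaves a single orbit. -/
theorem InClosed.exists_isBackwardCycle {W : Finset V} (hW : D.InClosed W) (hq : q ≤ W.card)
    (hmin : ∀ W' : Finset V, W' ⊆ W → D.InClosed W' → q ≤ W'.card → W' = W)
    (hlarge : 2 * q < W.card) : ∃ e L, D.IsBackwardCycle W e L := by
  classical
  choose! p hpW hp using hW
  have hmaps : Set.MapsTo p (W : Set V) W := fun v hv => hpW v hv
  have hsurj : ∀ w ∈ W, ∃ v ∈ W, p v = w := by
    intro w hw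
    by_contra! h
    have hc : W.erase w = W := by
      apply hmin _ (Finset.erase_subset _ _)
      · intro v hv
        have hv := Finset.mem_of_mem_erase hv
        exact ⟨p v, Finset.mem_erase.2 ⟨h v hv, hpW v hv⟩, hp v hv⟩
      · rw [Finset.card_erase_of_mem hw]; omega
    rw [Finset.erase_eq_self] at hc
    exact hc hw
  have hinj : Set.InjOn p (W : Set V) :=
    Finset.injOn_of_surjOn_of_card_le p hmaps (fun w hw => by
      obtain ⟨v, hv, h⟩ := hsurj w hw
      exact ⟨v, hv, h⟩) le_rfl
  let f : W → W := fun v => ⟨p v, hpW v v.2⟩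
  have hf : Function.Injective f := fun a b h =>
    Subtype.ext (hinj a.2 b.2 (congrArg Subtype.val h))
  have hne : W.Nonempty := Finset.card_pos.1 (by omega)
  obtain ⟨w, hw⟩ := hne
  let w' : W := ⟨w, hw⟩
  have hL : 0 < Function.minimalPeriod f w' :=
    Function.minimalPeriod_pos_of_mem_periodicPts (hf.mem_periodicPts w')
  set L := Function.minimalPeriod f w' with hLdef
  let e : ℕ → V := fun i => (f^[i] w' : W)
  have hper : ∀ i, e (i + L) = e i := fun i =>
    congrArg Subtype.val Function.iterate_add_minimalPeriod_eq
  have he1 : ∀ i, e (i + 1) = p (e i) := fun i => by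
    simp only [e, Function.iterate_succ_apply']; rfl
  have hmem : ∀ i, e i ∈ W := fun i => (f^[i] w').2
  have hmod : ∀ i, e (i % L) = e i := fun i =>
    congrArg Subtype.val Function.iterate_mod_minimalPeriod_eq
  have hinjm : ∀ i j, e i = e j → i % L = j % L := by
    intro i j h
    rw [← hmod i, ← hmod j] at h
    exact Function.iterate_injOn_Iio_minimalPeriod (Nat.mod_lt _ hL) (Nat.mod_lt _ hL)
      (Subtype.ext h)
  -- Each window of `L` consecutive positions meets every vertex of the orbit; `L - a % L` plays the
  -- role of `-a` modulo `L`.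
  have hshift : ∀ a i, ∃ j, a ≤ j ∧ j < a + L ∧ e j = e i := by
    intro a i
    refine ⟨a + (i + (L - a % L)) % L, by omega, by have := Nat.mod_lt (i + (L - a % L)) hL; omega,
      ?_⟩
    rw [← hmod, ← hmod i]
    congr 1
    have h1 := Nat.mod_lt a hL
    conv_lhs => rw [Nat.add_mod_mod, ← Nat.mod_add_mod]
    have : a % L + (i + (L - a % L)) = i + L := by omega
    rw [this, Nat.add_mod_right]
  set O := W.filter fun v => ∃ i, e i = v with hO
  have hOin : D.InClosed O := by
    intro v hv
    obtain ⟨hvW, i, rfl⟩ := Finset.mem_filter.1 hv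
    exact ⟨p (e i), Finset.mem_filter.2 ⟨hpW _ hvW, i + 1, he1 i⟩, hp _ hvW⟩
  have hOc : D.InClosed (W \ O) := by
    intro v hv
    obtain ⟨hvW, hvO⟩ := Finset.mem_sdiff.1 hv
    refine ⟨p v, Finset.mem_sdiff.2 ⟨hpW _ hvW, fun h => hvO ?_⟩, hp _ hvW⟩
    obtain ⟨_, i, hi⟩ := Finset.mem_filter.1 h
    -- Since `p v = e i`, injectivity makes `v` the orbit element before `e i`; `i + (L - 1)` stands
    -- for `i - 1`.
    refine Finset.mem_filter.2 ⟨hvW, i + (L - 1), hinj (hmem _) hvW ?_⟩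
    rw [← he1, ← hi, ← hper i]
    congr 1; omega
  have hOW : O = W := by
    by_contra hOW
    have h1 : O.card < q := by
      by_contra h
      exact hOW (hmin O (Finset.filter_subset _ _) hOin (not_lt.1 h))
    have h2 : (W \ O).card < q := by
      by_contra h
      have := hmin _ Finset.sdiff_subset hOc (not_lt.1 h)
      have hwO : w ∈ O := Finset.mem_filter.2 ⟨hw, 0, rfl⟩
      rw [← this] at hw
      exact (Finset.mem_sdiff.1 hw).2 hwO
    have := Finset.card_sdiff_add_card_eq_card (Finset.filter_subset (fun v => ∃ i, e i = v) W)
    rw [← hO] at this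
    omega
  refine ⟨e, L, hL, fun i => he1 i ▸ hp _ (hmem i), hper, ?_, hmem, ?_⟩
  · intro a i j hi hj hi' hj' h
    have h := hinjm i j h
    have h1 := Nat.div_add_mod i L
    have h2 := Nat.div_add_mod j L
    rcases lt_trichotomy (i / L) (j / L) with h3 | h3 | h3
    · have := Nat.mul_le_mul_left L (Nat.succ_le_of_lt h3)
      rw [Nat.mul_succ] at this
      omega
    · rw [h3] at h1; omega
    · have := Nat.mul_le_mul_left L (Nat.succ_le_of_lt h3)
      rw [Nat.mul_succ] at this
      omega
  · intro a v hv
    rw [← hOW] at hv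
    obtain ⟨_, i, rfl⟩ := Finset.mem_filter.1 hv
    exact hshift a i

end Digraph

/-! ### Detours around a vertex of the cycle -/

namespace Digraph

variable {V : Type*} [DecidableEq V] {D : Digraph V} {q : ℕ} {X : Finset V}

/-- The cycle `e` can be left at position `j` and entered again at position `l` through vertices
of `Q` outside the cycle (or `Q` alone has no sources and leads to position `l`). -/
structure IsDetour (D : Digraph V) (W X : Finset V) (e : ℕ → V) (L l j : ℕ) (Q : Finset V) :
    Prop where
  le : j ≤ l + L
  disjoint_cycle : Disjoint Q W
  disjoint_left : Disjoint Q X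
  exists_adj : ∀ v, v ∈ Q ∨ v = e l → ∃ w, (w ∈ Q ∨ w = e j) ∧ D.Adj w v

/-- Let `l` be the last position before `i` with `e l ∈ U`, and follow in-neighbours inside `U` from
`e l`. If this walk returns to the cycle, it does so at a position `k ≤ l` by the choice of `l`; one
turn later this is `j = k + L > i`, and the vertices passed in between form `Q`. If it never
returns, the walk itself is a source-free `Q`, and `j = l + L` will do. -/
theorem IsBackwardCycle.exists_detour {W U : Finset V} {e : ℕ → V} {L i : ℕ}
    (he : D.IsBackwardCycle W e L) (hU : D.InClosed U) (hUX : Disjoint U X) (hi : e i ∉ U)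
    (hLi : L ≤ i) (hUW : ¬ Disjoint U W) :
    ∃ l j Q, l < i ∧ i < j ∧ D.IsDetour W X e L l j Q := by
  classical
  choose! p hpU hp using hU
  -- The offset `d` counts backwards from `i - 1`, so the least one gives the last position before
  -- `i`.
  have hex : ∃ d, d < L ∧ e (i - 1 - d) ∈ U := by
    obtain ⟨v, hvU, hvW⟩ := Finset.not_disjoint_iff.1 hUW
    obtain ⟨k, hk, hk', rfl⟩ := he.surj (i - L) v hvW
    refine ⟨i - 1 - k, by omega, ?_⟩
    have : i - 1 - (i - 1 - k) = k := by omega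
    rwa [this]
  obtain ⟨hdL, hlU⟩ := Nat.find_spec hex
  have hmin := fun d' (hd' : d' < Nat.find hex) => Nat.find_min hex hd'
  generalize Nat.find hex = d at hdL hlU hmin
  have hL := he.pos
  have hdL' : d ≠ L - 1 := by
    rintro rfl
    have : e (i - 1 - (L - 1)) = e i := by
      rw [← he.period]; congr 1; omega
    exact hi (this ▸ hlU)
  set l := i - 1 - d with hl
  have horb : ∀ t, p^[t] (e l) ∈ U := by
    intro t
    induction t with
    | zero => exact hlU
    | succ t ih => rw [Function.iterate_succ_apply']; exact hpU _ ih
  -- The exponent is `t + 1` because the start `e l`, itself on the cycle, is no return.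
  by_cases hit : ∃ t, p^[t + 1] (e l) ∈ W
  · have hT := Nat.find_spec hit
    have hTmin := fun t (ht : t < Nat.find hit) => Nat.find_min hit ht
    generalize Nat.find hit = T at hT hTmin
    obtain ⟨k, hk, hk', hek⟩ := he.surj (i - L) _ hT
    have hkU : e k ∈ U := hek ▸ horb _
    have hkl : k ≤ l := by
      by_contra hlt
      apply hmin (i - 1 - k) (by omega)
      have : i - 1 - (i - 1 - k) = k := by omega
      exact ⟨by omega, by rwa [this]⟩
    have hki : i - L ≠ k := by
      intro h
      apply hi
      rw [← show i - L + L = i by omega, he.period, h]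
      exact hkU
    refine ⟨l, k + L, (Finset.range T).image fun t => p^[t + 1] (e l), by omega, by omega,
      by omega, ?_, ?_, ?_⟩
    · rw [Finset.disjoint_left]
      intro v hv
      obtain ⟨t, ht, rfl⟩ := Finset.mem_image.1 hv
      exact hTmin t (Finset.mem_range.1 ht)
    · refine Finset.disjoint_of_subset_left ?_ hUX
      intro v hv
      obtain ⟨t, ht, rfl⟩ := Finset.mem_image.1 hv
      exact horb _
    · have key : ∀ t, t ≤ T → ∃ w, (w ∈ (Finset.range T).image (fun t => p^[t + 1] (e l)) ∨
          w = e (k + L)) ∧ D.Adj w (p^[t] (e l)) := by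
        intro t ht
        refine ⟨p^[t + 1] (e l), ?_, ?_⟩
        · rcases ht.lt_or_eq with h | rfl
          · exact Or.inl (Finset.mem_image.2 ⟨t, Finset.mem_range.2 h, rfl⟩)
          · exact Or.inr (by rw [he.period, hek])
        · rw [Function.iterate_succ_apply']; exact hp _ (horb t)
      rintro v (hv | rfl)
      · obtain ⟨t, ht, rfl⟩ := Finset.mem_image.1 hv
        exact key _ (Finset.mem_range.1 ht)
      · exact key 0 (Nat.zero_le _)
  · push Not at hit
    refine ⟨l, l + L, U.filter fun v => ∃ t, p^[t + 1] (e l) = v, by omega, by omega, le_rfl,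
      ?_, ?_, ?_⟩
    · rw [Finset.disjoint_left]
      intro v hv
      obtain ⟨_, t, rfl⟩ := Finset.mem_filter.1 hv
      exact hit t
    · exact Finset.disjoint_of_subset_left (Finset.filter_subset _ _) hUX
    · have key : ∀ t, ∃ w, (w ∈ U.filter (fun v => ∃ t, p^[t + 1] (e l) = v) ∨
          w = e (l + L)) ∧ D.Adj w (p^[t] (e l)) := by
        intro t
        refine ⟨p^[t + 1] (e l), Or.inl (Finset.mem_filter.2 ⟨horb _, t, rfl⟩), ?_⟩
        rw [Function.iterate_succ_apply']; exact hp _ (horb t)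
      rintro v (hv | rfl)
      · obtain ⟨_, t, rfl⟩ := Finset.mem_filter.1 hv
        exact key _
      · exact key 0

/-- The threshold `c` cuts off the `m` smallest elements of `T`. The last clause ensures that the
cut does not pass the end `j` of a detour. -/
theorem exists_card_filter_lt_eq (T : Finset ℕ) {m : ℕ} (hm : m ≤ T.card) :
    ∃ c, (T.filter (· < c)).card = m ∧ ∀ b, (∀ i ∈ T, i < b) → c ≤ b := by
  induction m with
  | zero => exact ⟨0, by simp, by simp⟩
  | succ m ih =>
    obtain ⟨c, hc, -⟩ := ih (by omega)
    have hne : (T.filter (c ≤ ·)).Nonempty := by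
      rw [← Finset.card_pos]
      have := Finset.card_filter_add_card_filter_not (s := T) (· < c)
      simp only [not_lt] at this
      omega
    set d := (T.filter (c ≤ ·)).min' hne with hd
    have hdm := Finset.mem_filter.1 (Finset.min'_mem _ hne)
    rw [← hd] at hdm
    refine ⟨d + 1, ?_, fun b hb => hb d hdm.1⟩
    have : T.filter (· < d + 1) = insert d (T.filter (· < c)) := by
      ext i
      simp only [Finset.mem_filter, Finset.mem_insert]
      constructor
      · rintro ⟨hi, hid⟩
        by_cases hic : i < c
        · exact Or.inr ⟨hi, hic⟩
        · have := Finset.min'_le (T.filter (c ≤ ·)) i (Finset.mem_filter.2 ⟨hi, not_lt.1 hic⟩)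
          left; omega
      · rintro (rfl | ⟨hi, hic⟩)
        · exact ⟨hdm.1, Nat.lt_succ_self _⟩
        · exact ⟨hi, by omega⟩
    rw [this, Finset.card_insert_of_notMem, hc]
    simp only [Finset.mem_filter, not_and]
    omega

/-- A single long detour suffices: the first `m` bypassed positions of `B` are given up, and the
cycle from the cut `c` to `l + L` is kept together with `Q`. This part contains `q` further bypassed
vertices as well as `e j`, and `e (l + L) = e l` has its in-neighbour in `Q` or at `e j`. -/
theorem IsDetour.exists_subset {W : Finset V} {e : ℕ → V} {L l j m : ℕ} {Q B : Finset V}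
    (he : D.IsBackwardCycle W e L) (hWX : Disjoint W X) (hQ : D.IsDetour W X e L l j Q)
    (hcard : m + q ≤ ((Finset.Ioo l j).filter (e · ∈ B)).card) :
    ∃ S ⊆ B, m ≤ S.card ∧ D.Spares q (X ∪ S) := by
  set T := (Finset.Ioo l j).filter (e · ∈ B) with hT
  obtain ⟨c, hc, hcle⟩ := exists_card_filter_lt_eq T (m := m) (by omega)
  have hle := hQ.le
  have hTmem : ∀ i ∈ T, l < i ∧ i < j ∧ e i ∈ B := fun i hi => by
    obtain ⟨h1, h2⟩ := Finset.mem_filter.1 hi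
    rw [Finset.mem_Ioo] at h1
    exact ⟨h1.1, h1.2, h2⟩
  have hinj : Set.InjOn e (T : Set ℕ) := fun i hi i' hi' h => by
    have h1 := hTmem i hi
    have h2 := hTmem i' hi'
    exact he.inj l i i' (by omega) (by omega) (by omega) (by omega) h
  have hcj : c ≤ j := hcle j fun i hi => (hTmem i hi).2.1
  have hrest : q ≤ (T.filter (c ≤ ·)).card := by
    have := Finset.card_filter_add_card_filter_not (s := T) (· < c)
    simp only [not_lt] at this
    omega
  refine ⟨(T.filter (· < c)).image e, ?_, ?_, Q ∪ (Finset.Icc c (l + L)).image e, ?_, ?_, ?_⟩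
  · intro v hv
    obtain ⟨i, hi, rfl⟩ := Finset.mem_image.1 hv
    exact (hTmem i (Finset.mem_filter.1 hi).1).2.2
  · rw [Finset.card_image_of_injOn
      (hinj.mono fun i hi => (Finset.mem_filter.1 (Finset.mem_coe.1 hi)).1), hc]
  · have h1 : (Finset.Icc c (l + L)).image e ⊆ W := by
      intro v hv
      obtain ⟨i, _, rfl⟩ := Finset.mem_image.1 hv
      exact he.mem i
    have h2 : (T.filter (· < c)).image e ⊆ W := by
      intro v hv
      obtain ⟨i, _, rfl⟩ := Finset.mem_image.1 hv
      exact he.mem i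
    rw [Finset.disjoint_union_left, Finset.disjoint_union_right, Finset.disjoint_union_right]
    refine ⟨⟨hQ.disjoint_left, Finset.disjoint_of_subset_right h2 hQ.disjoint_cycle⟩,
      Finset.disjoint_of_subset_left h1 hWX, ?_⟩
    rw [Finset.disjoint_left]
    intro v hv hv'
    obtain ⟨i, hi, rfl⟩ := Finset.mem_image.1 hv
    obtain ⟨i', hi', hii⟩ := Finset.mem_image.1 hv'
    obtain ⟨h3, h4⟩ := Finset.mem_filter.1 hi'
    have h5 := hTmem i' h3
    rw [Finset.mem_Icc] at hi
    have := he.inj (l + 1) i' i (by omega) (by omega) (by omega) (by omega) hii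
    omega
  · have key : ∀ v, v ∈ Q ∨ v = e l →
        ∃ u ∈ Q ∪ (Finset.Icc c (l + L)).image e, D.Adj u v := by
      intro v hv
      obtain ⟨w, hw, hwv⟩ := hQ.exists_adj v hv
      refine ⟨w, ?_, hwv⟩
      rcases hw with hw | rfl
      · exact Finset.mem_union_left _ hw
      · exact Finset.mem_union_right _ (Finset.mem_image_of_mem _ (Finset.mem_Icc.2 ⟨hcj, hle⟩))
    intro v hv
    rcases Finset.mem_union.1 hv with hv | hv
    · exact key v (Or.inl hv)
    · obtain ⟨i, hi, rfl⟩ := Finset.mem_image.1 hv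
      rw [Finset.mem_Icc] at hi
      rcases hi.2.lt_or_eq with h | rfl
      · exact ⟨e (i + 1), Finset.mem_union_right _ (Finset.mem_image_of_mem _
          (Finset.mem_Icc.2 ⟨by omega, h⟩)), he.adj i⟩
      · exact key _ (Or.inr (he.period l))
  · rw [← Finset.card_image_of_injOn
      (hinj.mono fun i hi => (Finset.mem_filter.1 (Finset.mem_coe.1 hi)).1)] at hrest
    refine hrest.trans (Finset.card_le_card ?_)
    refine (Finset.image_subset_image ?_).trans Finset.subset_union_right
    intro i hi
    obtain ⟨h1, h2⟩ := Finset.mem_filter.1 hi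
    have := hTmem i h1
    exact Finset.mem_Icc.2 ⟨h2, by omega⟩

end Digraph

/-! ### Sparing many vertices at once, and the branching rule -/

namespace Digraph

variable {V : Type*} [DecidableEq V] {D : Digraph V} {q : ℕ} {X : Finset V}

/-- Divide `2K² + 1` positions of `B` into `K` blocks of length `2K`, neighbouring blocks sharing an
end. A detour around the middle of a block bypasses too few positions to leave the block, so these
`K` detours are compatible. The middles are given up, at least `m` vertices; the first positions of
the blocks are kept, at least `q` vertices. -/
theorem IsBackwardCycle.exists_subset {W B : Finset V} {e : ℕ → V} {L m K : ℕ}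
    (he : D.IsBackwardCycle W e L) (hWX : Disjoint W X)
    (hB : ∀ u ∈ B, D.Spares q (insert u X)) (hm : m ≤ K) (hq : q ≤ K) (hK : 0 < K)
    (hcard : 2 * K * K + 1 ≤ (B ∩ W).card)
    (hdet : ∀ l j Q, D.IsDetour W X e L l j Q →
      ((Finset.Ioo l j).filter (e · ∈ B)).card < K) :
    ∃ S ⊆ B, m ≤ S.card ∧ D.Spares q (X ∪ S) := by
  -- A set `U` that misses the cycle spares all of `B ∩ W`.
  by_cases hmeet : ∃ U, D.InClosed U ∧ Disjoint U X ∧ q ≤ U.card ∧ Disjoint U W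
  · obtain ⟨U, hU, hUX, hUq, hUW⟩ := hmeet
    refine ⟨B ∩ W, Finset.inter_subset_left, by nlinarith, U, ?_, hU, hUq⟩
    rw [Finset.disjoint_union_right]
    exact ⟨hUX, Finset.disjoint_of_subset_right Finset.inter_subset_right hUW⟩
  push Not at hmeet
  -- Positions are taken from the second turn, so that a full turn precedes each of them, as
  -- `exists_detour` requires.
  set P := (Finset.Ico L (L + L)).filter (e · ∈ B) with hP
  have hPcard : (B ∩ W).card ≤ P.card := by
    refine le_trans (Finset.card_le_card (t := P.image e) ?_) Finset.card_image_le
    intro v hv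
    obtain ⟨hvB, hvW⟩ := Finset.mem_inter.1 hv
    obtain ⟨i, h1, h2, rfl⟩ := he.surj L v hvW
    exact Finset.mem_image_of_mem _ (Finset.mem_filter.2 ⟨Finset.mem_Ico.2 ⟨h1, h2⟩, hvB⟩)
  have hPmem : ∀ i ∈ P, L ≤ i ∧ i < L + L ∧ e i ∈ B := fun i hi => by
    obtain ⟨h1, h2⟩ := Finset.mem_filter.1 hi
    rw [Finset.mem_Ico] at h1
    exact ⟨h1.1, h1.2, h2⟩
  -- an increasing enumeration of the positions of `B`
  obtain ⟨b, hbP, hb⟩ : ∃ b : ℕ → ℕ, (∀ k ≤ 2 * K * K, b k ∈ P) ∧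
      ∀ k k', k < k' → k' ≤ 2 * K * K → b k < b k' := by
    have h0 : 0 < P.card := by omega
    let f := P.orderEmbOfFin rfl
    refine ⟨fun k => if h : k < P.card then f ⟨k, h⟩ else 0, fun k hk => ?_,
      fun k k' hkk hk' => ?_⟩
    · simp only [dif_pos (show k < P.card by omega)]
      exact Finset.orderEmbOfFin_mem _ _ _
    · simp only [dif_pos (show k < P.card by omega), dif_pos (show k' < P.card by omega)]
      exact f.strictMono hkk
  have hbmono : ∀ k k', k ≤ k' → k' ≤ 2 * K * K → b k ≤ b k' := fun k k' h h' => by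
    rcases h.lt_or_eq with h | rfl
    · exact (hb _ _ h h').le
    · exact le_rfl
  have hinjb : ∀ k k', k ≤ 2 * K * K → k' ≤ 2 * K * K → b k = b k' → k = k' := by
    intro k k' hk hk' h
    rcases lt_trichotomy k k' with h1 | h1 | h1
    · have := hb _ _ h1 hk'; omega
    · exact h1
    · have := hb _ _ h1 hk; omega
  have hrange : ∀ t < K, 2 * t * K + 2 * K ≤ 2 * K * K := fun t ht => by nlinarith
  have hdetour : ∀ t, ∃ l j Q, t < K → l < b (2 * t * K + K) ∧ b (2 * t * K + K) < j ∧
      D.IsDetour W X e L l j Q := by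
    intro t
    by_cases ht : t < K
    swap
    · exact ⟨0, 0, ∅, fun h => absurd h ht⟩
    have h1 := hPmem _ (hbP (2 * t * K + K) (by have := hrange t ht; omega))
    obtain ⟨U, hUX, hU, hUq⟩ := hB _ h1.2.2
    rw [Finset.disjoint_insert_right] at hUX
    obtain ⟨l, j, Q, h⟩ := he.exists_detour hU hUX.2 hUX.1 h1.1 (hmeet U hU hUX.2 hUq)
    exact ⟨l, j, Q, fun _ => h⟩
  choose l j Q hdetour using hdetour
  -- A detour around `b k, …, b (k + K)` would bypass `K + 1` positions of `B`.
  have hcount : ∀ t < K, ∀ k, k + K ≤ 2 * K * K → l t < b k → b (k + K) < j t → False := by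
    intro t ht k hk h1 h2
    have h3 := hdet _ _ _ (hdetour t ht).2.2
    have h4 : (Finset.Icc k (k + K)).card ≤
        ((Finset.Ioo (l t) (j t)).filter (e · ∈ B)).card := by
      refine Finset.card_le_card_of_injOn b ?_ ?_
      · intro i hi
        have hi := Finset.mem_Icc.1 (Finset.mem_coe.1 hi)
        have h5 := hbmono k i hi.1 (by omega)
        have h6 := hbmono i (k + K) hi.2 hk
        exact Finset.mem_coe.2 (Finset.mem_filter.2 ⟨Finset.mem_Ioo.2 ⟨by omega, by omega⟩,
          (hPmem _ (hbP i (by omega))).2.2⟩)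
      · intro i hi i' hi' h
        have hi := Finset.mem_Icc.1 (Finset.mem_coe.1 hi)
        have hi' := Finset.mem_Icc.1 (Finset.mem_coe.1 hi')
        exact hinjb i i' (by omega) (by omega) h
    rw [Nat.card_Icc] at h4
    omega
  have hl : ∀ t < K, b (2 * t * K) ≤ l t := by
    intro t ht
    by_contra h
    have := hrange t ht
    exact hcount t ht (2 * t * K) (by omega) (by omega) (hdetour t ht).2.1
  have hj : ∀ t < K, j t ≤ b (2 * t * K + 2 * K) := by
    intro t ht
    by_contra h
    have := hrange t ht
    refine hcount t ht (2 * t * K + K) (by omega) (hdetour t ht).1 ?_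
    rw [show 2 * t * K + K + K = 2 * t * K + 2 * K by ring]
    omega
  have hjl : ∀ t t', t < t' → t' < K → j t ≤ b (2 * t' * K) := by
    intro t t' h h'
    refine (hj t (h.trans h')).trans (hbmono _ _ ?_ ?_)
    · nlinarith
    · have := hrange t' h'; omega
  set S := (Finset.range K).image fun t => e (b (2 * t * K + K)) with hS
  -- The surviving part of the cycle: only positions strictly inside a detour are dropped.
  set R := (Finset.Ico L (L + L)).filter fun i => ∀ t < K, ¬ (l t < i ∧ i < j t) with hR
  have hRmem : ∀ i, L ≤ i → i < L + L → (∀ t < K, ¬ (l t < i ∧ i < j t)) → i ∈ R :=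
    fun i h1 h2 h3 => Finset.mem_filter.2 ⟨Finset.mem_Ico.2 ⟨h1, h2⟩, h3⟩
  have hSW : S ⊆ W := by
    intro v hv
    obtain ⟨t, _, rfl⟩ := Finset.mem_image.1 hv
    exact he.mem _
  have hRW : R.image e ⊆ W := by
    intro v hv
    obtain ⟨t, _, rfl⟩ := Finset.mem_image.1 hv
    exact he.mem _
  refine ⟨S, ?_, ?_, (Finset.range K).biUnion Q ∪ R.image e, ?_, ?_, ?_⟩
  · intro v hv
    obtain ⟨t, ht, rfl⟩ := Finset.mem_image.1 hv
    have := hrange t (Finset.mem_range.1 ht)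
    exact (hPmem _ (hbP _ (by omega))).2.2
  · rw [hS, Finset.card_image_of_injOn, Finset.card_range]
    · exact hm
    · intro t ht t' ht' h
      have h1 := hrange t (Finset.mem_range.1 (Finset.mem_coe.1 ht))
      have h2 := hrange t' (Finset.mem_range.1 (Finset.mem_coe.1 ht'))
      have h3 := hPmem _ (hbP (2 * t * K + K) (by omega))
      have h4 := hPmem _ (hbP (2 * t' * K + K) (by omega))
      have h5 := hinjb _ _ (by omega) (by omega)
        (he.inj L _ _ h3.1 h4.1 h3.2.1 h4.2.1 h)
      have h6 : t * (2 * K) = t' * (2 * K) := by linarith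
      exact Nat.eq_of_mul_eq_mul_right (by omega) h6
  · rw [Finset.disjoint_union_left, Finset.disjoint_union_right, Finset.disjoint_union_right]
    refine ⟨⟨?_, ?_⟩, Finset.disjoint_of_subset_left hRW hWX, ?_⟩
    · exact (Finset.disjoint_biUnion_left _ _ _).2 fun t ht =>
        (hdetour t (Finset.mem_range.1 ht)).2.2.disjoint_left
    · exact (Finset.disjoint_biUnion_left _ _ _).2 fun t ht =>
        Finset.disjoint_of_subset_right hSW
          (hdetour t (Finset.mem_range.1 ht)).2.2.disjoint_cycle
    · rw [Finset.disjoint_left]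
      intro v hv hv'
      obtain ⟨i, hi, rfl⟩ := Finset.mem_image.1 hv
      obtain ⟨t, ht, hti⟩ := Finset.mem_image.1 hv'
      have ht := Finset.mem_range.1 ht
      obtain ⟨h1, h2⟩ := Finset.mem_filter.1 hi
      rw [Finset.mem_Ico] at h1
      have h3 := hPmem _ (hbP (2 * t * K + K) (by have := hrange t ht; omega))
      have h4 := he.inj L _ _ h3.1 h1.1 h3.2.1 h1.2 hti
      have h5 := hdetour t ht
      exact h2 t ht (h4 ▸ ⟨h5.1, h5.2.1⟩)
  · have hjR : ∀ t < K, j t ∈ R := by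
      intro t ht
      have h1 := hrange t ht
      have h2 := hPmem _ (hbP (2 * t * K + K) (by omega))
      have h3 := hPmem _ (hbP (2 * t * K + 2 * K) (by omega))
      have h4 := hdetour t ht
      have h5 := hj t ht
      refine hRmem _ (by omega) (by omega) fun t' ht' h => ?_
      rcases lt_trichotomy t t' with h6 | h6 | h6
      · have := hjl t t' h6 ht'
        have := hl t' ht'
        omega
      · subst h6; omega
      · have := hjl t' t h6 ht
        have := hl t ht
        omega
    have key : ∀ t < K, ∀ v, v ∈ Q t ∨ v = e (l t) →
        ∃ u ∈ (Finset.range K).biUnion Q ∪ R.image e, D.Adj u v := by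
      intro t ht v hv
      obtain ⟨w, hw, hwv⟩ := (hdetour t ht).2.2.exists_adj v hv
      refine ⟨w, ?_, hwv⟩
      rcases hw with hw | rfl
      · exact Finset.mem_union_left _ (Finset.mem_biUnion.2 ⟨t, Finset.mem_range.2 ht, hw⟩)
      · exact Finset.mem_union_right _ (Finset.mem_image_of_mem _ (hjR t ht))
    intro v hv
    rcases Finset.mem_union.1 hv with hv | hv
    · obtain ⟨t, ht, hv⟩ := Finset.mem_biUnion.1 hv
      exact key t (Finset.mem_range.1 ht) v (Or.inl hv)
    · obtain ⟨i, hi, rfl⟩ := Finset.mem_image.1 hv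
      obtain ⟨h1, h2⟩ := Finset.mem_filter.1 hi
      rw [Finset.mem_Ico] at h1
      by_cases hlt : ∃ t < K, l t = i
      · obtain ⟨t, ht, rfl⟩ := hlt
        exact key t ht _ (Or.inr rfl)
      push Not at hlt
      -- At the end of the window the in-neighbour is `e (2L) = e L`; position `L` survives because
      -- every `l t` is at least `L`.
      by_cases hL : i + 1 = L + L
      · refine ⟨e L, Finset.mem_union_right _ (Finset.mem_image_of_mem _
          (hRmem L le_rfl (by omega) fun t ht h => ?_)), ?_⟩
        · have h3 := hl t ht
          have h4 := (hPmem _ (hbP (2 * t * K) (by have := hrange t ht; omega))).1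
          omega
        · have := he.adj i
          rwa [hL, he.period] at this
      · refine ⟨e (i + 1), Finset.mem_union_right _ (Finset.mem_image_of_mem _
          (hRmem _ (by omega) (by omega) fun t ht h => ?_)), he.adj i⟩
        have := hlt t ht
        exact h2 t ht ⟨by omega, by omega⟩
  · refine hq.trans ?_
    calc K = (Finset.range K).card := (Finset.card_range K).symm
      _ ≤ (R.image e).card := by
        refine Finset.card_le_card_of_injOn (fun t => e (b (2 * t * K))) ?_ ?_
        · intro t ht
          have ht := Finset.mem_range.1 (Finset.mem_coe.1 ht)
          have h1 := hPmem _ (hbP (2 * t * K) (by have := hrange t ht; omega))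
          refine Finset.mem_coe.2 (Finset.mem_image_of_mem _
            (hRmem _ h1.1 h1.2.1 fun t' ht' h => ?_))
          rcases lt_or_ge t' t with h6 | h6
          · have := hjl t' t h6 ht
            omega
          · have := hl t' ht'
            have := hbmono (2 * t * K) (2 * t' * K) (by nlinarith)
              (by have := hrange t' ht'; omega)
            omega
        · intro t ht t' ht' h
          have h1 := hrange t (Finset.mem_range.1 (Finset.mem_coe.1 ht))
          have h2 := hrange t' (Finset.mem_range.1 (Finset.mem_coe.1 ht'))
          have h3 := hPmem _ (hbP (2 * t * K) (by omega))
          have h4 := hPmem _ (hbP (2 * t' * K) (by omega))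
          have h5 := hinjb _ _ (by omega) (by omega)
            (he.inj L _ _ h3.1 h4.1 h3.2.1 h4.2.1 h)
          have h6 : t * (2 * K) = t' * (2 * K) := by linarith
          exact Nat.eq_of_mul_eq_mul_right (by omega) h6
      _ ≤ _ := Finset.card_le_card Finset.subset_union_right

/-- Among sufficiently many vertices each of which can be spared, there are `m` vertices that can
be spared simultaneously. -/
theorem exists_subset_spares {B : Finset V} {m K : ℕ} (hB : ∀ u ∈ B, D.Spares q (insert u X))
    (hK : m + q ≤ K) (hcard : 2 * K * K + 2 * K + 1 ≤ B.card) :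
    ∃ S ⊆ B, m ≤ S.card ∧ D.Spares q (X ∪ S) := by
  classical
  obtain ⟨u, hu⟩ : B.Nonempty := Finset.card_pos.1 (by omega)
  have hex : ∃ c, ∃ W : Finset V, Disjoint W X ∧ D.InClosed W ∧ q ≤ W.card ∧ W.card = c := by
    obtain ⟨W, h1, h2, h3⟩ := (hB u hu).mono (Finset.subset_insert _ _)
    exact ⟨_, W, h1, h2, h3, rfl⟩
  obtain ⟨W, hWX, hW, hWq, hc⟩ := Nat.find_spec hex
  have hmin : ∀ W' : Finset V, W' ⊆ W → D.InClosed W' → q ≤ W'.card → W' = W := by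
    intro W' h1 h2 h3
    refine Finset.eq_of_subset_of_card_le h1 ?_
    rw [hc]
    exact Nat.find_min' hex ⟨W', Finset.disjoint_of_subset_left h1 hWX, h2, h3, rfl⟩
  by_cases hBW : m ≤ (B \ W).card
  · refine ⟨B \ W, Finset.sdiff_subset, hBW, W, ?_, hW, hWq⟩
    exact Finset.disjoint_union_right.2 ⟨hWX, Finset.disjoint_sdiff⟩
  -- Fewer than `m` vertices of `B` lie outside `W`. The summand `2K` of the bound absorbs them,
  -- leaving `2K² + 1` in `B ∩ W`, and gives `|W| > 2q`.
  have h1 := Finset.card_sdiff_add_card_inter B W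
  have h2 := Finset.card_le_card (Finset.inter_subset_right : B ∩ W ⊆ W)
  obtain ⟨e, L, he⟩ := hW.exists_isBackwardCycle hWq hmin (by omega)
  by_cases hdet : ∃ l j Q, D.IsDetour W X e L l j Q ∧
      K ≤ ((Finset.Ioo l j).filter (e · ∈ B)).card
  · obtain ⟨l, j, Q, hQ, hle⟩ := hdet
    exact hQ.exists_subset he hWX (hK.trans hle)
  · push Not at hdet
    exact he.exists_subset hWX hB (by omega) (by omega) (by omega) (by omega) hdet

/-- The tree `X` can be enlarged to a tree with at least `m` vertices that spares `q` vertices. -/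
def Extends (D : Digraph V) (s : V) (m q : ℕ) (X : Finset V) : Prop :=
  ∃ Y, X ⊆ Y ∧ D.Grown s Y ∧ m ≤ Y.card ∧ D.Spares q Y

/-- The tree `X` can be enlarged by the vertex `u` such that `q` vertices are spared. -/
def IsCandidate (D : Digraph V) (q : ℕ) (X : Finset V) (u : V) : Prop :=
  u ∉ X ∧ (∃ x ∈ X, D.Adj x u) ∧ D.Spares q (insert u X)

/-- If `C` contains all candidates, one of them lies on the way to `Y`. If `C` is merely large, `m`
of its vertices can be added together, since all are out-neighbours of `X`; each of these is a good
first choice, although `Y` may avoid it. -/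
theorem Extends.exists_insert {s : V} {m : ℕ} {C : Finset V} (h : D.Extends s m q X)
    (hX : D.Grown s X) (hm : X.card < m) (hC : ∀ u ∈ C, D.IsCandidate q X u)
    (hall : (∀ u, D.IsCandidate q X u → u ∈ C) ∨
      2 * (m + q) * (m + q) + 2 * (m + q) + 1 ≤ C.card) :
    ∃ u ∈ C, D.Extends s m q (insert u X) := by
  rcases hall with hall | hcard
  · obtain ⟨Y, hXY, hY, hmY, hsp⟩ := h
    have hne : X ≠ Y := by rintro rfl; omega
    obtain ⟨u, huY, huX, hu⟩ := hY.exists_adj hX.root_mem hXY hne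
    have hsub := Finset.insert_subset huY hXY
    exact ⟨u, hall u ⟨huX, hu, hsp.mono hsub⟩, Y, hsub, hY, hmY, hsp⟩
  · obtain ⟨S, hSC, hmS, hS⟩ := exists_subset_spares (fun u hu => (hC u hu).2.2) le_rfl hcard
    obtain ⟨u, hu⟩ : S.Nonempty := Finset.card_pos.1 (by omega)
    refine ⟨u, hSC hu, X ∪ S, ?_, hX.union S fun v hv => (hC v (hSC hv)).2.1, ?_, hS⟩
    · exact Finset.insert_subset (Finset.mem_union_right _ hu) Finset.subset_union_left
    · exact hmS.trans (Finset.card_le_card Finset.subset_union_right)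

end Digraph

/-! ### Out-branchings and grown trees -/

namespace Digraph

variable {V : Type*} {D : Digraph V} {s : V}

theorem one_le_inDegree_iff [Finite V] {v : V} : 1 ≤ D.inDegree v ↔ ∃ u, D.Adj u v := by
  rw [inDegree, Nat.one_le_iff_ne_zero, Ne, Set.ncard_eq_zero (Set.toFinite _),
    ← Ne, ← Set.nonempty_iff_ne_empty]
  rfl

theorem minInDegreeAtLeast_one_iff {W : Finset V} :
    (D.inducedOn (W : Set V)).MinInDegreeAtLeast 1 ↔ D.InClosed W := by
  constructor
  · intro h v hv
    obtain ⟨u, hu⟩ := one_le_inDegree_iff.1 (h ⟨v, hv⟩)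
    exact ⟨u, u.2, hu⟩
  · intro h v
    obtain ⟨u, hu, huv⟩ := h v v.2
    exact one_le_inDegree_iff.2 ⟨⟨u, hu⟩, huv⟩

/-- Follow an undirected walk from the root. If it uses an arc `c → b` backwards, then `b` is not
the root and `c` is its only in-neighbour, so the directed path to `b` already passes through `c`.
-/
theorem IsOutTree.reflTransGen [Finite V] {T : Digraph V} (hT : T.IsOutTree s) (v : V) :
    Relation.ReflTransGen T.Adj s v := by
  obtain ⟨hconn, hs, hdeg⟩ := hT
  obtain ⟨w⟩ := hconn.preconnected s v
  induction w using SimpleGraph.Walk.concatRec with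
  | Hnil => exact .refl
  | @Hconcat a b c p h ih =>
    have ih := ih hs hdeg
    obtain ⟨-, h | h⟩ := h
    · exact ih.tail h
    · rcases Relation.ReflTransGen.cases_tail ih with rfl | ⟨d, hd, hdb⟩
      · rw [inDegree, Set.ncard_eq_zero (Set.toFinite _)] at hs
        exact absurd h (Set.eq_empty_iff_forall_notMem.1 hs c)
      · have hb : b ≠ a := by
          rintro rfl
          rw [inDegree, Set.ncard_eq_zero (Set.toFinite _)] at hs
          exact absurd h (Set.eq_empty_iff_forall_notMem.1 hs c)
        obtain ⟨x, hx⟩ := Set.ncard_eq_one.1 (hdeg b hb)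
        have h1 : c ∈ ({x} : Set V) := hx ▸ h
        have h2 : d ∈ ({x} : Set V) := hx ▸ hdb
        rw [Set.mem_singleton_iff] at h1 h2
        rw [h1, ← h2]
        exact hd

variable [DecidableEq V]

/-- A grown subset of `U` of maximal size absorbs all vertices along the directed paths of the
out-branching. The second clause is what `IsValidRoot` asks of the vertices of `U`. -/
theorem HasOutBranching.exists_grown {U : Finset V}
    (h : (D.inducedOn (U : Set V)).HasOutBranching) :
    ∃ s, D.Grown s U ∧ ∀ v ∈ U, v ≠ s → ∃ u, D.Adj u v := by
  classical
  obtain ⟨T, hTD, s, hT⟩ := h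
  refine ⟨s, ?_, fun v hv hvs => ?_⟩
  swap
  · have h1 := hT.2.2 ⟨v, hv⟩ fun h => hvs (congrArg Subtype.val h)
    obtain ⟨u, hu⟩ := one_le_inDegree_iff.1 h1.ge
    exact ⟨u, hTD hu⟩
  obtain ⟨X, hX, hmax⟩ := Finset.exists_max_image (U.powerset.filter fun X => D.Grown s.1 X)
    Finset.card ⟨{s.1}, Finset.mem_filter.2
      ⟨Finset.mem_powerset.2 (Finset.singleton_subset_iff.2 s.2), Grown.root⟩⟩
  obtain ⟨hXU, hX⟩ := Finset.mem_filter.1 hX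
  rw [Finset.mem_powerset] at hXU
  suffices hUX : U ⊆ X from Finset.Subset.antisymm hXU hUX ▸ hX
  suffices key : ∀ v : (U : Set V), v.1 ∈ X from fun v hv => key ⟨v, hv⟩
  intro v
  induction hT.reflTransGen v with
  | refl => exact hX.root_mem
  | @tail b c _ hbc ih =>
    by_contra hc
    have h1 := hX.grow hc ih (hTD hbc)
    have h2 := hmax (insert c.1 X) (Finset.mem_filter.2
      ⟨Finset.mem_powerset.2 (Finset.insert_subset c.2 hXU), h1⟩)
    rw [Finset.card_insert_of_notMem hc] at h2
    omega

/-- The rank `rk` is the depth in the tree; its decrease along `par` makes every vertex reachable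
from the root. -/
theorem Grown.exists_parent {X : Finset V} (h : D.Grown s X) :
    ∃ (par : V → V) (rk : V → ℕ), ∀ v ∈ X, v ≠ s →
      par v ∈ X ∧ D.Adj (par v) v ∧ rk (par v) < rk v := by
  induction h with
  | root =>
    exact ⟨id, fun _ => 0, fun v hv hvs => absurd (Finset.mem_singleton.1 hv) hvs⟩
  | @grow X x u hX hu hx hxu ih =>
    obtain ⟨par, rk, h⟩ := ih
    have hux : x ≠ u := fun h => hu (h ▸ hx)
    refine ⟨Function.update par u x, Function.update rk u (rk x + 1), fun v hv hvs => ?_⟩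
    rcases Finset.mem_insert.1 hv with rfl | hvX
    · simp [hux, hx, hxu]
    · have hvu : v ≠ u := fun h => hu (h ▸ hvX)
      obtain ⟨h1, h2, h3⟩ := h v hvX hvs
      have hpu : par v ≠ u := fun h => hu (h ▸ h1)
      simp [hvu, hpu, h1, h2, h3]

theorem Grown.hasOutBranching {X : Finset V} (h : D.Grown s X) :
    (D.inducedOn (X : Set V)).HasOutBranching := by
  obtain ⟨par, rk, hpar⟩ := h.exists_parent
  let s' : (X : Set V) := ⟨s, h.root_mem⟩
  let T : Digraph (X : Set V) := ⟨fun u v => v ≠ s' ∧ par v = u⟩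
  have hne : ∀ v : (X : Set V), v ≠ s' → v.1 ≠ s := fun v hv h => hv (Subtype.ext h)
  refine ⟨T, ?_, s', ?_, ?_, ?_⟩
  · rintro u v ⟨hv, huv⟩
    have := (hpar v v.2 (hne v hv)).2.1
    rwa [huv] at this
  · have key : ∀ k, ∀ v : (X : Set V), rk v = k → T.toSimpleGraphInclusive.Reachable s' v := by
      intro k
      induction k using Nat.strong_induction_on with
      | _ k ih =>
        intro v hv
        by_cases hvs : v = s'
        · rw [hvs]
        · obtain ⟨h1, h2, h3⟩ := hpar v v.2 (hne v hvs)
          refine (ih _ (hv ▸ h3) ⟨par v, h1⟩ rfl).trans (SimpleGraph.Adj.reachable ⟨?_, Or.inl ?_⟩)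
          · intro h
            have := congrArg (fun v : (X : Set V) => rk v) h
            simp only at this
            omega
          · exact ⟨hvs, rfl⟩
    have : Nonempty (X : Set V) := ⟨s'⟩
    exact ⟨fun u v => ((key _ u rfl).symm).trans (key _ v rfl)⟩
  · rw [inDegree, Set.ncard_eq_zero (Set.toFinite _), Set.eq_empty_iff_forall_notMem]
    rintro u ⟨h, -⟩
    exact h rfl
  · intro u hu
    rw [inDegree, Set.ncard_eq_one]
    refine ⟨⟨par u, (hpar u u.2 (hne u hu)).1⟩, ?_⟩
    ext v
    constructor
    · rintro ⟨-, h⟩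
      exact Subtype.ext h.symm
    · rintro rfl
      exact ⟨hu, rfl⟩

end Digraph

/-! ### From partitions to trees that spare a source-free set -/

namespace PartitionInput

/-- Every vertex except possibly `s` has an in-neighbour. -/
def IsValidRoot (I : PartitionInput) (s : Fin I.n) : Prop := ∀ v, v ≠ s → ∃ u, I.D.Adj u v

/-- Only `W` is needed to certify `k₂`; maximality of the tree assigns the other vertices. One
outside `X` and `W` has an in-neighbour, and if this were in `X` the tree could grow. -/
theorem hasPartition_iff (I : PartitionInput) :
    I.HasPartition ↔ ∃ s, I.IsValidRoot s ∧ I.D.Extends s I.k₁ I.k₂ {s} := by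
  classical
  constructor
  · rintro ⟨V₁, V₂, hdisj, hun, h1, h2, hk1, hk2⟩
    obtain ⟨s, hs, hin⟩ := h1.exists_grown
    rw [Digraph.minInDegreeAtLeast_one_iff] at h2
    refine ⟨s, fun v hvs => ?_, V₁, by simpa using hs.root_mem, hs, hk1, V₂, hdisj.symm, h2, hk2⟩
    have : v ∈ V₁ ∪ V₂ := hun ▸ Finset.mem_univ v
    rcases Finset.mem_union.1 this with hv | hv
    · exact hin v hv hvs
    · obtain ⟨u, -, hu⟩ := h2 v hv
      exact ⟨u, hu⟩
  · rintro ⟨s, hs, Y, hsY, hY, hk1, W, hWY, hW, hk2⟩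
    obtain ⟨X, hX, hmax⟩ := Finset.exists_max_image
      (Finset.univ.filter fun X => I.D.Grown s X ∧ Y ⊆ X ∧ Disjoint W X) Finset.card
      ⟨Y, by simpa using ⟨hY, hWY⟩⟩
    obtain ⟨hX, hYX, hWX⟩ := (Finset.mem_filter.1 hX).2
    refine ⟨X, Finset.univ \ X, Finset.disjoint_sdiff, by simp, hX.hasOutBranching,
      Digraph.minInDegreeAtLeast_one_iff.2 ?_, hk1.trans (Finset.card_le_card hYX),
      hk2.trans (Finset.card_le_card fun v hv => ?_)⟩
    · intro v hv
      have hvX := (Finset.mem_sdiff.1 hv).2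
      by_cases hvW : v ∈ W
      · obtain ⟨u, hu, huv⟩ := hW v hvW
        exact ⟨u, by simpa using Finset.disjoint_left.1 hWX hu, huv⟩
      · obtain ⟨u, huv⟩ := hs v fun h => hvX (h ▸ hX.root_mem)
        refine ⟨u, ?_, huv⟩
        simp only [Finset.mem_sdiff, Finset.mem_univ, true_and]
        intro hu
        have := hmax (insert v X) (Finset.mem_filter.2 ⟨Finset.mem_univ _, hX.grow hvX hu huv,
          hYX.trans (Finset.subset_insert _ _), Finset.disjoint_insert_right.2 ⟨hvW, hWX⟩⟩)
        rw [Finset.card_insert_of_notMem hvX] at this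
        omega
    · simpa using Finset.disjoint_left.1 hWX hv

end PartitionInput

/-! ## A language of terminating programs -/

namespace RAM

/-- The state after assigning the value `v` to the register `x`. -/
def State.setReg (s : State) (x v : ℕ) : State := ⟨Function.update s.reg x v, s.arr⟩

/-- The state after storing the value `v` in the cell `i` of the array `a`. -/
def State.setArr (s : State) (a i v : ℕ) : State :=
  ⟨s.reg, Function.update s.arr a (Function.update (s.arr a) i v)⟩

section

variable (s : State) (x y a b i j v : ℕ)

@[simp] theorem State.setReg_reg : (s.setReg x v).reg y = if y = x then v else s.reg y := by
  simp [State.setReg, Function.update_apply]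

@[simp] theorem State.setReg_arr : (s.setReg x v).arr = s.arr := rfl

@[simp] theorem State.setArr_reg : (s.setArr a i v).reg = s.reg := rfl

@[simp] theorem State.setArr_arr :
    (s.setArr a i v).arr b j = if b = a ∧ j = i then v else s.arr b j := by
  by_cases h : b = a
  · subst h
    by_cases h' : j = i <;> simp [State.setArr, h']
  · simp [State.setArr, h]

end

/-- Programs whose only loops are bounded ones: in `iter x b p`, the register `x` runs downwards
through the numbers below the value of the register `b`. -/
inductive Code where
  | skip
  | assign (x : ℕ) (e : Expr)
  | store (a : ℕ) (i e : Expr)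
  | seq (p q : Code)
  | cond (e : Expr) (p q : Code)
  | iter (x b : ℕ) (p : Code)

namespace Code

/-- The loop of a bounded iteration: `f` is applied for the values `k - 1, …, 0` of `x`. -/
def iterDen (f : State → State) (x : ℕ) : ℕ → State → State
  | 0, s => s
  | k + 1, s => iterDen f x k (f (s.setReg x k))

/-- The state in which a program ends. -/
def den : Code → State → State
  | skip, s => s
  | assign x e, s => s.setReg x (e.eval s)
  | store a i e, s => s.setArr a (i.eval s) (e.eval s)
  | seq p q, s => q.den (p.den s)
  | cond e p q, s => if e.eval s ≠ 0 then p.den s else q.den s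
  | iter x b p, s => iterDen p.den x (s.reg b) (s.setReg x (s.reg b))

theorem den_seq (p q : Code) (s : State) : (seq p q).den s = q.den (p.den s) := rfl

theorem den_cond_of_ne {e : Expr} {s : State} (h : e.eval s ≠ 0) (p q : Code) :
    (cond e p q).den s = p.den s := if_pos h

theorem den_cond_of_eq {e : Expr} {s : State} (h : e.eval s = 0) (p q : Code) :
    (cond e p q).den s = q.den s := if_neg (not_not.2 h)

/-- The translation into machine programs. -/
def compile : Code → Prog
  | skip => .skip
  | assign x e => .assign x e
  | store a i e => .store a i e
  | seq p q => .seq p.compile q.compile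
  | cond e p q => .cond e p.compile q.compile
  | iter x b p => .seq (.assign x (.reg b))
      (.loop (.reg x) (.seq (.assign x (.sub (.reg x) (.lit 1))) p.compile))

/-- The registers to which a program writes. -/
def regs : Code → List ℕ
  | skip => []
  | assign x _ => [x]
  | store _ _ _ => []
  | seq p q => p.regs ++ q.regs
  | cond _ p q => p.regs ++ q.regs
  | iter x _ p => x :: p.regs

/-- The arrays to which a program writes. -/
def arrs : Code → List ℕ
  | skip => []
  | assign _ _ => []
  | store a _ _ => [a]
  | seq p q => p.arrs ++ q.arrs
  | cond _ p q => p.arrs ++ q.arrs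
  | iter _ _ p => p.arrs

/-- The registers that bound the iterations of a program. -/
def bounds : Code → List ℕ
  | skip => []
  | assign _ _ => []
  | store _ _ _ => []
  | seq p q => p.bounds ++ q.bounds
  | cond _ p q => p.bounds ++ q.bounds
  | iter _ b p => b :: p.bounds

/-- No iteration changes its own counter. -/
def WellFormed : Code → Prop
  | skip => True
  | assign _ _ => True
  | store _ _ _ => True
  | seq p q => p.WellFormed ∧ q.WellFormed
  | cond _ p q => p.WellFormed ∧ q.WellFormed
  | iter x _ p => x ∉ p.regs ∧ p.WellFormed

instance decidableWellFormed : (p : Code) → Decidable p.WellFormed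
  | skip => .isTrue trivial
  | assign _ _ => .isTrue trivial
  | store _ _ _ => .isTrue trivial
  | seq p q => @instDecidableAnd _ _ (decidableWellFormed p) (decidableWellFormed q)
  | cond _ p q => @instDecidableAnd _ _ (decidableWellFormed p) (decidableWellFormed q)
  | iter _ _ p => @instDecidableAnd _ _ inferInstance (decidableWellFormed p)

/-- The depth of the nesting of iterations. -/
def depth : Code → ℕ
  | skip => 0
  | assign _ _ => 0
  | store _ _ _ => 0
  | seq p q => max p.depth q.depth
  | cond _ p q => max p.depth q.depth
  | iter _ _ p => p.depth + 1

/-- The time that a program needs, up to the lengths of its iterations. -/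
def weight : Code → ℕ
  | skip => 1
  | assign _ e => e.cost + 1
  | store _ i e => i.cost + e.cost + 1
  | seq p q => p.weight + q.weight
  | cond e p q => e.cost + p.weight + q.weight + 1
  | iter _ _ p => p.weight + 10

/-- The states `s` and `s'` agree outside of the memory to which `p` writes. -/
structure Agree (p : Code) (s s' : State) : Prop where
  reg : ∀ y, y ∉ p.regs → s'.reg y = s.reg y
  arr : ∀ a, a ∉ p.arrs → s'.arr a = s.arr a

theorem Agree.refl (p : Code) (s : State) : Agree p s s := ⟨fun _ _ => rfl, fun _ _ => rfl⟩

theorem iterDen_induction {f : State → State} {x k : ℕ} {s : State} (I : ℕ → State → Prop)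
    (h0 : I k s) (hstep : ∀ i < k, ∀ s', I (i + 1) s' → I i (f (s'.setReg x i))) :
    I 0 (iterDen f x k s) := by
  induction k generalizing s with
  | zero => exact h0
  | succ k ih =>
    exact ih (hstep k (Nat.lt_succ_self k) s h0) fun i hi => hstep i (hi.trans (Nat.lt_succ_self k))

theorem agree_den (p : Code) (s : State) : Agree p s (p.den s) := by
  induction p generalizing s with
  | skip => exact .refl _ _
  | assign x e =>
    refine ⟨fun y hy => ?_, fun _ _ => rfl⟩
    simp only [regs, List.mem_singleton] at hy
    simp [den, hy]
  | store a i e =>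
    refine ⟨fun _ _ => rfl, fun b hb => ?_⟩
    simp only [arrs, List.mem_singleton] at hb
    funext j
    simp [den, hb]
  | seq p q hp hq =>
    refine ⟨fun y hy => ?_, fun a ha => ?_⟩
    · simp only [regs, List.mem_append, not_or] at hy
      rw [den, (hq _).reg y hy.2, (hp _).reg y hy.1]
    · simp only [arrs, List.mem_append, not_or] at ha
      rw [den, (hq _).arr a ha.2, (hp _).arr a ha.1]
  | cond e p q hp hq =>
    refine ⟨fun y hy => ?_, fun a ha => ?_⟩
    · simp only [regs, List.mem_append, not_or] at hy
      rw [den]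
      split_ifs
      · exact (hp _).reg y hy.1
      · exact (hq _).reg y hy.2
    · simp only [arrs, List.mem_append, not_or] at ha
      rw [den]
      split_ifs
      · exact (hp _).arr a ha.1
      · exact (hq _).arr a ha.2
  | iter x b p hp =>
    refine iterDen_induction (fun _ s' => Agree (iter x b p) s s') ⟨fun y hy => ?_, fun _ _ => rfl⟩
      fun i _ s' hs' => ⟨fun y hy => ?_, fun a ha => ?_⟩
    · simp only [regs, List.mem_cons, not_or] at hy
      simp [hy.1]
    · have h := hs'.reg y hy
      simp only [regs, List.mem_cons, not_or] at hy
      rw [(hp _).reg y hy.2, ← h]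
      simp [hy.1]
    · rw [(hp (s'.setReg x i)).arr a ha, State.setReg_arr, hs'.arr a ha]

/-- `I i` describes the state when the counter values from `i` upwards have been treated. The step
may use that memory not written by the iteration is unchanged. -/
theorem den_iter_induction {x b : ℕ} {p : Code} {s : State} (I : ℕ → State → Prop)
    (h0 : I (s.reg b) (s.setReg x (s.reg b)))
    (hstep : ∀ i < s.reg b, ∀ s', Agree (iter x b p) s s' → I (i + 1) s' →
      I i (p.den (s'.setReg x i))) :
    I 0 ((iter x b p).den s) := by
  refine (iterDen_induction (s := s.setReg x (s.reg b))
    (fun i s' => Agree (iter x b p) s s' ∧ I i s') ⟨⟨fun y hy => ?_,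
    fun _ _ => rfl⟩, h0⟩ fun i hi s' hs' => ⟨⟨fun y hy => ?_, fun a ha => ?_⟩,
      hstep i hi s' hs'.1 hs'.2⟩).2
  · simp only [regs, List.mem_cons, not_or] at hy
    simp [hy.1]
  · have h := hs'.1.reg y hy
    simp only [regs, List.mem_cons, not_or] at hy
    rw [(agree_den _ _).reg y hy.2, ← h]
    simp [hy.1]
  · rw [(agree_den p _).arr a ha, State.setReg_arr, hs'.1.arr a ha]

/-- No bound and no counter is overwritten by the body, so the initial values of the bounds limit
all rounds, and each level of nesting costs a factor `M + 1`. Time estimates thus reduce to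
decidable checks on the syntax. -/
theorem exec_compile (p : Code) (M : ℕ) : ∀ s : State, p.WellFormed →
    (∀ b ∈ p.bounds, b ∉ p.regs ∧ s.reg b ≤ M) →
    ∃ t, Exec p.compile s (p.den s) t ∧ t ≤ p.weight * (M + 1) ^ p.depth := by
  induction p with
  | skip => exact fun s _ _ => ⟨1, .skip s, by simp [weight, depth]⟩
  | assign x e => exact fun s _ _ => ⟨_, .assign x e s, by simp [weight, depth]⟩
  | store a i e => exact fun s _ _ => ⟨_, .store a i e s, by simp [weight, depth]⟩
  | seq p q hp hq =>
    intro s hw hb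
    simp only [bounds, regs, List.mem_append, not_or] at hb
    obtain ⟨t, h1, ht⟩ := hp s hw.1 fun b h => ⟨(hb b (Or.inl h)).1.1, (hb b (Or.inl h)).2⟩
    obtain ⟨t', h2, ht'⟩ := hq (p.den s) hw.2 fun b h => ⟨(hb b (Or.inr h)).1.2, by
      rw [(agree_den p s).reg b (hb b (Or.inr h)).1.1]; exact (hb b (Or.inr h)).2⟩
    refine ⟨_, .seq h1 h2, ?_⟩
    rw [weight, depth, add_mul]
    exact Nat.add_le_add
      (ht.trans (Nat.mul_le_mul_left _ (Nat.pow_le_pow_right (by omega) (le_max_left _ _))))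
      (ht'.trans (Nat.mul_le_mul_left _ (Nat.pow_le_pow_right (by omega) (le_max_right _ _))))
  | cond e p q hp hq =>
    intro s hw hb
    simp only [bounds, regs, List.mem_append, not_or] at hb
    have hpos : 1 ≤ (M + 1) ^ max p.depth q.depth := Nat.one_le_pow _ _ (by omega)
    by_cases he : e.eval s = 0
    · obtain ⟨t, h1, ht⟩ := hq s hw.2 fun b h => ⟨(hb b (Or.inr h)).1.2, (hb b (Or.inr h)).2⟩
      refine ⟨_, by rw [den, if_neg (by simpa using he)]; exact .condFalse he h1, ?_⟩
      have := ht.trans (Nat.mul_le_mul_left q.weight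
        (Nat.pow_le_pow_right (by omega : M + 1 > 0) (le_max_right p.depth q.depth)))
      rw [weight, depth]
      nlinarith
    · obtain ⟨t, h1, ht⟩ := hp s hw.1 fun b h => ⟨(hb b (Or.inl h)).1.1, (hb b (Or.inl h)).2⟩
      refine ⟨_, by rw [den, if_pos he]; exact .condTrue he h1, ?_⟩
      have := ht.trans (Nat.mul_le_mul_left p.weight
        (Nat.pow_le_pow_right (by omega : M + 1 > 0) (le_max_left p.depth q.depth)))
      rw [weight, depth]
      nlinarith
  | iter x b p hp =>
    intro s hw hb
    have hbM := (hb b (by simp [bounds])).2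
    have hb' : ∀ c ∈ p.bounds, c ≠ x ∧ c ∉ p.regs ∧ s.reg c ≤ M := by
      intro c hc
      have := hb c (by simp [bounds, hc])
      simp only [regs, List.mem_cons, not_or] at this
      exact ⟨this.1.1, this.1.2, this.2⟩
    have hloop : ∀ k, ∀ s' : State, s'.reg x = k → (∀ c ∈ p.bounds, s'.reg c ≤ M) →
        ∃ t, Exec (.loop (.reg x) (.seq (.assign x (.sub (.reg x) (.lit 1))) p.compile)) s'
          (iterDen p.den x k s') t ∧ t ≤ 2 + k * (p.weight * (M + 1) ^ p.depth + 6) := by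
      intro k
      induction k with
      | zero => exact fun s' hs' _ => ⟨_, .loopDone hs', by simp [Expr.cost]⟩
      | succ k ih =>
        intro s' hs' hM
        have hset : (⟨Function.update s'.reg x ((Expr.sub (.reg x) (.lit 1)).eval s'), s'.arr⟩ :
            State) = s'.setReg x k := by
          simp [State.setReg, Expr.eval, hs']
        have h1 := Exec.assign x (.sub (.reg x) (.lit 1)) s'
        rw [hset] at h1
        obtain ⟨t, h2, ht⟩ := hp (s'.setReg x k) hw.2 fun c hc => ⟨(hb' c hc).2.1, by
          rw [State.setReg_reg, if_neg (hb' c hc).1]; exact hM c hc⟩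
        obtain ⟨t', h3, ht'⟩ := ih (p.den (s'.setReg x k))
          (by rw [(agree_den _ _).reg x hw.1]; simp) fun c hc => by
            rw [(agree_den _ _).reg c (hb' c hc).2.1, State.setReg_reg, if_neg (hb' c hc).1]
            exact hM c hc
        refine ⟨_, .loopStep (show Expr.eval s' (.reg x) ≠ 0 by simp [Expr.eval, hs'])
          (.seq h1 h2) h3, ?_⟩
        simp only [Expr.cost]
        rw [add_mul, one_mul]
        omega
    obtain ⟨t, h, ht⟩ := hloop (s.reg b) (s.setReg x (s.reg b)) (by simp) fun c hc => by
      rw [State.setReg_reg, if_neg (hb' c hc).1]; exact (hb' c hc).2.2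
    refine ⟨_, .seq (.assign x (.reg b) s) h, ?_⟩
    -- The `10` in `weight` pays 2 for setting the counter, 2 for the failing test and 6 for the
    -- overhead of a round.
    simp only [Expr.cost, weight, depth]
    have h1 : 1 ≤ (M + 1) ^ p.depth := Nat.one_le_pow _ _ (by omega)
    have h2 := Nat.mul_le_mul_right (p.weight * (M + 1) ^ p.depth + 6) hbM
    rw [pow_succ]
    nlinarith [Nat.zero_le (p.weight * (M + 1) ^ p.depth), Nat.zero_le (M * (M + 1) ^ p.depth)]

/-- A loop with an invariant `I` that is indexed by a decreasing measure. -/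
theorem exec_loop (p : Code) (e : Expr) (I : ℕ → State → Prop) (M : ℕ)
    (hw : p.WellFormed) (hb : ∀ k s, I k s → ∀ b ∈ p.bounds, b ∉ p.regs ∧ s.reg b ≤ M)
    (hI : ∀ k s, I k s → e.eval s ≠ 0 → ∃ k' < k, I k' (p.den s)) :
    ∀ k s, I k s → ∃ k' s' t, Exec (.loop e p.compile) s s' t ∧ I k' s' ∧ e.eval s' = 0 ∧
      t ≤ (k + 1) * (p.weight * (M + 1) ^ p.depth + e.cost + 1) := by
  intro k
  induction k using Nat.strong_induction_on with
  | _ k ih =>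
    intro s hs
    by_cases he : e.eval s = 0
    · exact ⟨k, s, _, .loopDone he, hs, he, by rw [add_mul, one_mul]; omega⟩
    · obtain ⟨k', hk', h1⟩ := hI k s hs he
      obtain ⟨t, h3, ht⟩ := exec_compile p M s hw (hb k s hs)
      obtain ⟨k₁, s', t', h4, h5, h6, ht'⟩ := ih k' hk' _ h1
      refine ⟨k₁, s', _, .loopStep he h3 h4, h5, h6, ?_⟩
      have := Nat.mul_le_mul_right (p.weight * (M + 1) ^ p.depth + e.cost + 1) hk'
      rw [add_mul _ 1, one_mul]
      rw [Nat.succ_eq_add_one] at this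
      omega

end Code

end RAM

/-! ## The search program -/

namespace PartitionInput

open RAM

namespace Reg

/-- The length of the input. -/
@[simp] abbrev len : ℕ := 0
/-- The first demand. -/
@[simp] abbrev k₁ : ℕ := 1
/-- The second demand. -/
@[simp] abbrev k₂ : ℕ := 2
/-- The number of vertices. -/
@[simp] abbrev n : ℕ := 3
/-- The part of the input that is being read. -/
@[simp] abbrev phase : ℕ := 4
/-- The value of the next binary digit. -/
@[simp] abbrev pow : ℕ := 5
/-- The position in the input. -/
@[simp] abbrev pos : ℕ := 6
/-- A loop counter. -/
@[simp] abbrev i : ℕ := 7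
/-- The number of iterations in the computation of the branching limit. -/
@[simp] abbrev times : ℕ := 8
/-- The increment in the computation of the branching limit. -/
@[simp] abbrev incr : ℕ := 9
/-- The branching limit. -/
@[simp] abbrev limit : ℕ := 10
/-- The first free cell of the stack. -/
@[simp] abbrev top : ℕ := 11
/-- The answer. -/
@[simp] abbrev ans : ℕ := 12
/-- A vertex. -/
@[simp] abbrev u : ℕ := 13
/-- A loop counter. -/
@[simp] abbrev round : ℕ := 14
/-- A vertex. -/
@[simp] abbrev v : ℕ := 15
/-- A vertex. -/
@[simp] abbrev w : ℕ := 16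
/-- Whether an in-neighbour has been found. -/
@[simp] abbrev found : ℕ := 17
/-- The size of a set. -/
@[simp] abbrev size : ℕ := 18
/-- The result of a test. -/
@[simp] abbrev test : ℕ := 19
/-- The number of children that may still be put on the stack. -/
@[simp] abbrev room : ℕ := 20

end Reg

namespace Arr

/-- The input. -/
@[simp] abbrev word : ℕ := 0
/-- The positions in the input of the rows of the adjacency matrix. -/
@[simp] abbrev row : ℕ := 1
/-- The stack of vertex sets. -/
@[simp] abbrev stack : ℕ := 2
/-- The set from which sources are removed. -/
@[simp] abbrev alive : ℕ := 3
/-- The current tree. -/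
@[simp] abbrev cur : ℕ := 4

end Arr

/-- Test whether the vertex in register `x` has an in-neighbour in the set stored in array `a`. -/
def findInNeighbor (a x : ℕ) : Code :=
  .seq (.assign Reg.found (.lit 0))
    (.iter Reg.w Reg.n
      (.cond (.sub (.add (.get a (.reg Reg.w))
          (.get Arr.word (.add (.get Arr.row (.reg Reg.w)) (.reg x)))) (.lit 1))
        (.assign Reg.found (.lit 1)) .skip))

/-- Initialize the set of alive vertices with the complement of the current tree. -/
def initAlive : Code :=
  .iter Reg.v Reg.n (.store Arr.alive (.reg Reg.v) (.sub (.lit 1) (.get Arr.cur (.reg Reg.v))))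

/-- Remove sources from the set of alive vertices. -/
def peelOnce : Code :=
  .iter Reg.v Reg.n (.seq (findInNeighbor Arr.alive Reg.v)
    (.store Arr.alive (.reg Reg.v)
      (.sub (.add (.get Arr.alive (.reg Reg.v)) (.reg Reg.found)) (.lit 1))))

/-- Remove sources from the set of alive vertices until none is left. -/
def peel : Code := .iter Reg.round Reg.n peelOnce

/-- Count the elements of the set stored in array `a`. -/
def count (a : ℕ) : Code :=
  .seq (.assign Reg.size (.lit 0))
    (.iter Reg.v Reg.n (.assign Reg.size (.add (.reg Reg.size) (.get a (.reg Reg.v)))))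

/-- Test whether the current tree spares sufficiently many vertices. -/
def testSpares : Code :=
  .seq initAlive (.seq peel (.seq (count Arr.alive)
    (.assign Reg.test (.sub (.lit 1) (.sub (.reg Reg.k₂) (.reg Reg.size))))))

open Classical in
/-- The array `a` contains the indicator function of `X`. -/
def Stores {n : ℕ} (s : State) (a : ℕ) (X : Finset (Fin n)) : Prop :=
  ∀ v : Fin n, s.arr a v = if v ∈ X then 1 else 0

open Classical in
/-- The instance has been read. -/
structure Loaded (I : PartitionInput) (s : State) : Prop where
  n_eq : s.reg Reg.n = I.n
  k₁_eq : s.reg Reg.k₁ = I.k₁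
  k₂_eq : s.reg Reg.k₂ = I.k₂
  adj : ∀ u v : Fin I.n, s.arr Arr.word (s.arr Arr.row u + v) = if I.D.Adj u v then 1 else 0

variable {I : PartitionInput} {s s' : State}

theorem Loaded.of_eq (h : I.Loaded s) (h1 : s'.reg Reg.n = s.reg Reg.n)
    (h2 : s'.reg Reg.k₁ = s.reg Reg.k₁) (h3 : s'.reg Reg.k₂ = s.reg Reg.k₂)
    (h4 : s'.arr Arr.word = s.arr Arr.word) (h5 : s'.arr Arr.row = s.arr Arr.row) :
    I.Loaded s' :=
  ⟨h1.trans h.n_eq, h2.trans h.k₁_eq, h3.trans h.k₂_eq, fun u v => by rw [h4, h5]; exact h.adj u v⟩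

theorem Loaded.of_agree {p : Code} (h : I.Loaded s) (ha : Code.Agree p s s')
    (hr : Reg.n ∉ p.regs ∧ Reg.k₁ ∉ p.regs ∧ Reg.k₂ ∉ p.regs)
    (hp : Arr.word ∉ p.arrs ∧ Arr.row ∉ p.arrs) : I.Loaded s' :=
  h.of_eq (ha.reg _ hr.1) (ha.reg _ hr.2.1) (ha.reg _ hr.2.2) (ha.arr _ hp.1) (ha.arr _ hp.2)

theorem Loaded.setReg (h : I.Loaded s) {x : ℕ} (k : ℕ) (hx : 3 < x) : I.Loaded (s.setReg x k) := by
  refine h.of_eq ?_ ?_ ?_ rfl rfl <;> simp <;> omega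

theorem Loaded.setArr (h : I.Loaded s) {a : ℕ} (i k : ℕ) (ha : 1 < a) :
    I.Loaded (s.setArr a i k) := by
  refine h.of_eq rfl rfl rfl ?_ ?_ <;> funext j <;> simp <;> omega

theorem Stores.of_eq {n : ℕ} {X : Finset (Fin n)} {a : ℕ} (h : Stores s a X)
    (ha : s'.arr a = s.arr a) : Stores s' a X := fun v => by rw [ha, h v]

/-- Both summands of the test are 0 or 1, so adding them and subtracting 1 amounts to conjunction.
-/
theorem findInNeighbor_spec {a x : ℕ} {A : Finset (Fin I.n)} {v : Fin I.n} (hs : I.Loaded s)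
    (hA : Stores s a A) (hv : s.reg x = v) (hx : x ≠ Reg.found ∧ x ≠ Reg.w) :
    ((findInNeighbor a x).den s).reg Reg.found ≠ 0 ↔ ∃ u ∈ A, I.D.Adj u v := by
  classical
  have key : ∀ s : State, I.Loaded s → Stores s a A → s.reg x = v → s.reg Reg.found = 0 →
      (((Code.iter Reg.w Reg.n (.cond (.sub (.add (.get a (.reg Reg.w))
          (.get Arr.word (.add (.get Arr.row (.reg Reg.w)) (.reg x)))) (.lit 1))
        (.assign Reg.found (.lit 1)) .skip)).den s).reg Reg.found ≠ 0 ↔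
      ∃ u ∈ A, I.D.Adj u v) := by
    intro s hs hA hv h0
    have := Code.den_iter_induction (x := Reg.w) (b := Reg.n)
      (p := .cond (.sub (.add (.get a (.reg Reg.w))
          (.get Arr.word (.add (.get Arr.row (.reg Reg.w)) (.reg x)))) (.lit 1))
        (.assign Reg.found (.lit 1)) .skip) (s := s)
      (fun i s' => s'.reg Reg.found ≠ 0 ↔ ∃ u ∈ A, i ≤ u.val ∧ I.D.Adj u v) ?_ ?_
    · simpa using this
    · simp only [hs.n_eq, State.setReg_reg]
      constructor
      · intro h; simp at h; exact absurd h0 h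
      · rintro ⟨u, _, hu, _⟩
        have := u.2
        omega
    · intro i hi s' ha ih
      rw [hs.n_eq] at hi
      have hx' : s'.reg x = v := by
        rw [ha.reg x (by simp [Code.regs]; exact ⟨hx.2, hx.1⟩), hv]
      have h1 : s'.arr = s.arr := funext fun b => ha.arr b (by simp [Code.arrs])
      have h2 := hA ⟨i, hi⟩
      have h3 := hs.adj ⟨i, hi⟩ v
      simp only at h2 h3
      have hsplit : (∃ u ∈ A, i ≤ u.val ∧ I.D.Adj u v) ↔
          (⟨i, hi⟩ ∈ A ∧ I.D.Adj ⟨i, hi⟩ v) ∨ ∃ u ∈ A, i + 1 ≤ u.val ∧ I.D.Adj u v := by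
        constructor
        · rintro ⟨u, hu, hiu, huv⟩
          rcases hiu.lt_or_eq with h | h
          · exact Or.inr ⟨u, hu, h, huv⟩
          · have : u = ⟨i, hi⟩ := Fin.ext h.symm
            exact Or.inl (this ▸ ⟨hu, huv⟩)
        · rintro (⟨h, h'⟩ | ⟨u, hu, hiu, huv⟩)
          · exact ⟨_, h, le_rfl, h'⟩
          · exact ⟨u, hu, by omega, huv⟩
      rw [hsplit, ← ih]
      simp only [Code.den, Expr.eval, State.setReg_reg, State.setReg_arr, h1, h2, if_true,
        if_neg hx.2, hx', h3]
      by_cases h4 : (⟨i, hi⟩ : Fin I.n) ∈ A <;> by_cases h5 : I.D.Adj ⟨i, hi⟩ v <;>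
        simp [h4, h5]
  rw [findInNeighbor, Code.den, Code.den]
  refine key _ (hs.setReg _ (by simp)) hA ?_ (by simp [Expr.eval])
  rw [State.setReg_reg, if_neg hx.1, hv]

end PartitionInput

/-! ### Correctness of the test for spared vertices -/

namespace PartitionInput

open RAM

variable {I : PartitionInput} {s s' : State}

/-- Common to all loops that fill an array. In `push`, `base` is the top of the stack and the second
part protects the cells below; elsewhere `base` is 0. -/
theorem fill_spec {a base : ℕ} {idx e : Expr} {f : ℕ → ℕ}
    (h : ∀ i < s.reg Reg.n, ∀ s', Code.Agree (.iter Reg.v Reg.n (.store a idx e)) s s' →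
      idx.eval (s'.setReg Reg.v i) = base + i ∧ e.eval (s'.setReg Reg.v i) = f i) :
    (∀ i < s.reg Reg.n,
      ((Code.iter Reg.v Reg.n (.store a idx e)).den s).arr a (base + i) = f i) ∧
    ∀ j < base, ((Code.iter Reg.v Reg.n (.store a idx e)).den s).arr a j = s.arr a j := by
  have := Code.den_iter_induction (x := Reg.v) (b := Reg.n) (p := .store a idx e) (s := s)
      (fun i s' => (∀ i' < s.reg Reg.n, i ≤ i' → s'.arr a (base + i') = f i') ∧
        ∀ j < base, s'.arr a j = s.arr a j) ?_ ?_
  · exact ⟨fun i hi => this.1 i hi (Nat.zero_le i), this.2⟩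
  · exact ⟨fun i hi hi' => absurd hi (by omega), fun j _ => rfl⟩
  · intro i hi s' ha ih
    obtain ⟨h1, h2⟩ := h i hi s' ha
    simp only [Code.den, h1, h2, State.setArr_arr, State.setReg_arr, true_and]
    refine ⟨fun i' hi' hii => ?_, fun j hj => ?_⟩
    · rcases hii.lt_or_eq with h3 | rfl
      · rw [if_neg (by omega), ih.1 i' hi' h3]
      · simp
    · rw [if_neg (by omega), ih.2 j hj]

theorem initAlive_spec {X : Finset (Fin I.n)} (hs : I.Loaded s) (hX : Stores s Arr.cur X) :
    Stores (initAlive.den s) Arr.alive (Finset.univ \ X) := by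
  classical
  have := (fill_spec (s := s) (a := Arr.alive) (base := 0) (idx := .reg Reg.v)
    (e := .sub (.lit 1) (.get Arr.cur (.reg Reg.v))) (f := fun i => 1 - s.arr Arr.cur i) ?_).1
  · intro v
    have h1 := this v (by rw [hs.n_eq]; exact v.2)
    rw [zero_add, hX v] at h1
    rw [initAlive, h1]
    by_cases h : v ∈ X <;> simp [h]
  · intro i _ s' ha
    have := ha.arr Arr.cur (by simp [Code.arrs])
    simp [Expr.eval, this]

theorem count_spec {a : ℕ} {X : Finset (Fin I.n)} (hs : I.Loaded s) (hX : Stores s a X) :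
    ((count a).den s).reg Reg.size = X.card := by
  classical
  rw [count, Code.den, Code.den]
  have hs0 := hs.setReg (x := Reg.size) 0 (by simp)
  have := Code.den_iter_induction (x := Reg.v) (b := Reg.n)
      (p := .assign Reg.size (.add (.reg Reg.size) (.get a (.reg Reg.v))))
      (s := s.setReg Reg.size 0)
      (fun i s' => s'.reg Reg.size = (X.filter (i ≤ ·.val)).card) ?_ ?_
  · simpa [Expr.eval] using this
  · rw [hs0.n_eq, eq_comm, State.setReg_reg, if_neg (by simp), State.setReg_reg, if_pos rfl,
      Finset.card_eq_zero, Finset.filter_eq_empty_iff]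
    intro v _
    have := v.2
    omega
  · intro i hi s' ha ih
    rw [hs0.n_eq] at hi
    have h1 := hX ⟨i, hi⟩
    have h2 : s'.arr a = s.arr a := ha.arr a (by simp [Code.arrs])
    have h3 : X.filter (i ≤ ·.val) = X.filter (i + 1 ≤ ·.val) ∪ X.filter (· = ⟨i, hi⟩) := by
      rw [← Finset.filter_or]
      refine Finset.filter_congr fun v _ => ?_
      rw [Fin.ext_iff]
      simp only
      omega
    have h4 : Disjoint (X.filter (i + 1 ≤ ·.val)) (X.filter (· = ⟨i, hi⟩)) := by
      rw [Finset.disjoint_left]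
      intro v hv hv'
      have h5 := (Finset.mem_filter.1 hv).2
      have h6 := Fin.ext_iff.1 (Finset.mem_filter.1 hv').2
      simp only at h6
      omega
    rw [h3, Finset.card_union_of_disjoint h4, ← ih, Finset.filter_eq']
    simp only [Code.den, Expr.eval, State.setReg_reg, State.setReg_arr, h2] at h1 ⊢
    simp only [if_true, h1]
    by_cases h : (⟨i, hi⟩ : Fin I.n) ∈ X <;> simp [h]

/-- Removal happens in place, so a survivor is only known to have an in-neighbour in the initial set
`A`. This is enough once a round removes nothing. -/
theorem peelOnce_spec {A : Finset (Fin I.n)} (hs : I.Loaded s) (hA : Stores s Arr.alive A) :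
    ∃ A', Stores (peelOnce.den s) Arr.alive A' ∧ A' ⊆ A ∧
      (∀ W, I.D.InClosed W → W ⊆ A → W ⊆ A') ∧ ∀ v ∈ A', ∃ u ∈ A, I.D.Adj u v := by
  classical
  have := Code.den_iter_induction (x := Reg.v) (b := Reg.n)
    (p := .seq (findInNeighbor Arr.alive Reg.v) (.store Arr.alive (.reg Reg.v)
      (.sub (.add (.get Arr.alive (.reg Reg.v)) (.reg Reg.found)) (.lit 1)))) (s := s)
      (fun i s' => ∃ A' : Finset (Fin I.n), Stores s' Arr.alive A' ∧ A' ⊆ A ∧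
        (∀ W, I.D.InClosed W → W ⊆ A → W ⊆ A') ∧
        ∀ v ∈ A', i ≤ v.val → ∃ u ∈ A, I.D.Adj u v) ?_ ?_
  · simpa [peelOnce] using this
  · refine ⟨A, hA, subset_rfl, fun _ _ h => h, fun v _ hv => ?_⟩
    have := hs.n_eq
    omega
  · rintro i hi s' ha ⟨A', h1, h2, h3, h4⟩
    rw [hs.n_eq] at hi
    have hs' := (hs.of_agree ha (by decide) (by decide)).setReg (x := Reg.v) i (by simp)
    have hf := findInNeighbor_spec (v := ⟨i, hi⟩) (x := Reg.v) hs' (a := Arr.alive) (A := A') h1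
      (by simp) (by simp)
    rw [Code.den]
    have ha' := Code.agree_den (findInNeighbor Arr.alive Reg.v) (s'.setReg Reg.v i)
    set t := (findInNeighbor Arr.alive Reg.v).den (s'.setReg Reg.v i) with ht
    have hv : t.reg Reg.v = i := by rw [ha'.reg _ (by decide)]; simp
    have h1t : Stores t Arr.alive A' := h1.of_eq (ha'.arr _ (by decide))
    have hfound : t.reg Reg.found ≤ 1 := by
      rw [ht, findInNeighbor, Code.den, Code.den]
      refine Code.den_iter_induction (fun _ s' => s'.reg Reg.found ≤ 1) (by simp [Expr.eval]) ?_
      intro i _ s' _ hs'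
      rw [Code.den]
      split_ifs
      · simp [Code.den, Expr.eval]
      · simpa [Code.den] using hs'
    have hst : Stores (Code.den (.store Arr.alive (.reg Reg.v)
      (.sub (.add (.get Arr.alive (.reg Reg.v)) (.reg Reg.found)) (.lit 1))) t) Arr.alive
      (if t.reg Reg.found ≠ 0 then A' else A'.erase ⟨i, hi⟩) := by
      intro v
      have h5 := h1t v
      simp only [Code.den, Expr.eval, hv, State.setArr_arr, true_and]
      by_cases hvi : v.val = i
      · subst hvi
        rw [if_pos rfl, h5]
        by_cases h6 : t.reg Reg.found = 0
        · by_cases h7 : v ∈ A' <;> simp [h6, h7]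
        · have h7 : t.reg Reg.found = 1 := by omega
          simp [h7]
      · have hne : v ≠ ⟨i, hi⟩ := fun h => hvi (congrArg Fin.val h)
        rw [if_neg hvi, h5]
        by_cases h6 : t.reg Reg.found = 0 <;> simp [h6, hne]
    refine ⟨_, hst, ?_, ?_, ?_⟩
    · split_ifs
      · exact h2
      · exact (Finset.erase_subset _ _).trans h2
    · intro W hW hWA
      split_ifs with h6
      · exact h3 W hW hWA
      · refine Finset.subset_erase.2 ⟨h3 W hW hWA, fun hiW => h6 (hf.2 ?_)⟩
        obtain ⟨u, hu, huv⟩ := hW _ hiW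
        exact ⟨u, h3 W hW hWA hu, huv⟩
    · intro v hv hiv
      rcases hiv.lt_or_eq with h6 | h6
      · refine h4 v ?_ h6
        split_ifs at hv
        · exact hv
        · exact Finset.mem_of_mem_erase hv
      · have hvi : v = ⟨i, hi⟩ := Fin.ext h6.symm
        subst hvi
        split_ifs at hv with h7
        · obtain ⟨u, hu, huv⟩ := hf.1 h7
          exact ⟨u, h2 hu, huv⟩
        · exact absurd hv (Finset.notMem_erase _ _)

/-- Each round either finds the set source-free or shrinks it, so `n` rounds suffice; source-free
subsets are never touched, hence the result is the largest one. -/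
theorem peel_spec {A : Finset (Fin I.n)} (hs : I.Loaded s) (hA : Stores s Arr.alive A) :
    ∃ A', Stores (peel.den s) Arr.alive A' ∧ A' ⊆ A ∧ I.D.InClosed A' ∧
      ∀ W, I.D.InClosed W → W ⊆ A → W ⊆ A' := by
  classical
  have := Code.den_iter_induction (x := Reg.round) (b := Reg.n) (p := peelOnce) (s := s)
      (fun i s' => ∃ A' : Finset (Fin I.n), Stores s' Arr.alive A' ∧ A' ⊆ A ∧
        (∀ W, I.D.InClosed W → W ⊆ A → W ⊆ A') ∧ (I.D.InClosed A' ∨ A'.card ≤ i)) ?_ ?_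
  · obtain ⟨A', h1, h2, h3, h4⟩ := this
    refine ⟨A', h1, h2, h4.elim id fun h => ?_, h3⟩
    rw [Finset.card_eq_zero.1 (Nat.le_zero.1 h)]
    exact fun v hv => absurd hv (Finset.notMem_empty v)
  · refine ⟨A, hA, subset_rfl, fun _ _ h => h, Or.inr ?_⟩
    rw [hs.n_eq]
    exact (Finset.card_le_univ A).trans (Fintype.card_fin _).le
  · rintro i hi s' ha ⟨A', h1, h2, h3, h4⟩
    have hs' := (hs.of_agree ha (by decide) (by decide)).setReg (x := Reg.round) i (by simp)
    obtain ⟨B, h5, h6, h7, h8⟩ := peelOnce_spec hs' (A := A') h1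
    refine ⟨B, h5, h6.trans h2, fun W hW hWA => h7 W hW (h3 W hW hWA), ?_⟩
    by_cases hB : B = A'
    · subst hB
      exact Or.inl h8
    · have h9 := Finset.card_lt_card (h6.ssubset_of_ne hB)
      rcases h4 with h4 | h4
      · exact absurd (Finset.Subset.antisymm h6 (h7 A' h4 subset_rfl)) hB
      · right; omega

theorem testSpares_spec {X : Finset (Fin I.n)} (hs : I.Loaded s) (hX : Stores s Arr.cur X) :
    (testSpares.den s).reg Reg.test ≠ 0 ↔ I.D.Spares I.k₂ X := by
  classical
  have h1 := initAlive_spec hs hX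
  have hs1 := hs.of_agree (Code.agree_den initAlive s) (by decide) (by decide)
  obtain ⟨A, h2, h3, h4, h5⟩ := peel_spec hs1 h1
  have hs2 := hs1.of_agree (Code.agree_den peel _) (by decide) (by decide)
  have h6 := count_spec hs2 h2
  have hs3 := hs2.of_agree (Code.agree_den (count Arr.alive) _) (by decide) (by decide)
  simp only [testSpares, Code.den, Expr.eval, State.setReg_reg, if_true, h6, hs3.k₂_eq]
  constructor
  · intro h
    refine ⟨A, ?_, h4, by omega⟩
    exact Finset.disjoint_of_subset_left h3 Finset.sdiff_disjoint
  · rintro ⟨W, hWX, hW, hq⟩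
    have := Finset.card_le_card (h5 W hW fun v hv =>
      Finset.mem_sdiff.2 ⟨Finset.mem_univ v, Finset.disjoint_left.1 hWX hv⟩)
    omega

end PartitionInput

/-! ### The stack and the expansion of a tree -/

namespace PartitionInput

open RAM

/-- Put the current tree on the stack. -/
def push : Code :=
  .seq (.iter Reg.v Reg.n (.store Arr.stack (.add (.reg Reg.top) (.reg Reg.v))
      (.get Arr.cur (.reg Reg.v))))
    (.assign Reg.top (.add (.reg Reg.top) (.reg Reg.n)))

/-- Take the current tree from the stack. -/
def pop : Code :=
  .seq (.assign Reg.top (.sub (.reg Reg.top) (.reg Reg.n)))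
    (.iter Reg.v Reg.n (.store Arr.cur (.reg Reg.v)
      (.get Arr.stack (.add (.reg Reg.top) (.reg Reg.v)))))

/-- Put the current tree, enlarged by the vertex in register `Reg.u`, on the stack if it spares
sufficiently many vertices. -/
def tryPush : Code :=
  .seq (.store Arr.cur (.reg Reg.u) (.lit 1)) (.seq testSpares
    (.seq (.cond (.reg Reg.test) (.seq push (.assign Reg.room (.sub (.reg Reg.room) (.lit 1))))
        .skip)
      (.store Arr.cur (.reg Reg.u) (.lit 0))))

/-- Put children of the current tree on the stack. -/
def expand : Code :=
  .seq (.assign Reg.room (.reg Reg.limit))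
    (.iter Reg.u Reg.n (.cond (.reg Reg.room) (.cond (.get Arr.cur (.reg Reg.u)) .skip
      (.seq (findInNeighbor Arr.cur Reg.u) (.cond (.reg Reg.found) tryPush .skip))) .skip))

/-- Process the tree on top of the stack. -/
def step : Code :=
  .seq pop (.seq (count Arr.cur)
    (.cond (.sub (.reg Reg.k₁) (.reg Reg.size)) expand (.assign Reg.ans (.lit 1))))

open Classical in
/-- The cells of the memory contain the indicator functions of the sets in the list, the last one
first. -/
def StackHolds {n : ℕ} (m : ℕ → ℕ) : List (Finset (Fin n)) → Prop
  | [] => True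
  | X :: l => (∀ v : Fin n, m (l.length * n + v) = if v ∈ X then 1 else 0) ∧ StackHolds m l

/-- The contents of the stack. -/
structure IsStack {n : ℕ} (s : State) (l : List (Finset (Fin n))) : Prop where
  top : s.reg Reg.top = l.length * n
  holds : StackHolds (s.arr Arr.stack) l

theorem StackHolds.congr {n : ℕ} {m m' : ℕ → ℕ} {l : List (Finset (Fin n))} (h : StackHolds m l)
    (hm : ∀ j < l.length * n, m' j = m j) : StackHolds m' l := by
  induction l with
  | nil => trivial
  | cons X l ih =>
    rw [List.length_cons, add_mul, one_mul] at hm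
    refine ⟨fun v => ?_, ih h.2 fun j hj => hm j (by omega)⟩
    rw [hm _ (by have := v.2; omega), h.1 v]

variable {I : PartitionInput} {s s' : State} {l : List (Finset (Fin I.n))} {X : Finset (Fin I.n)}

theorem IsStack.of_eq (h : IsStack s l) (h1 : s'.reg Reg.top = s.reg Reg.top)
    (h2 : s'.arr Arr.stack = s.arr Arr.stack) : IsStack s' l :=
  ⟨h1.trans h.top, by rw [h2]; exact h.holds⟩

theorem IsStack.of_agree {p : Code} (h : IsStack s l) (ha : Code.Agree p s s')
    (h1 : Reg.top ∉ p.regs) (h2 : Arr.stack ∉ p.arrs) : IsStack s' l :=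
  h.of_eq (ha.reg _ h1) (ha.arr _ h2)

theorem push_spec (hs : I.Loaded s) (hX : Stores s Arr.cur X) (hl : IsStack s l) :
    IsStack (push.den s) (X :: l) := by
  obtain ⟨h1, h2⟩ := fill_spec (s := s) (a := Arr.stack) (base := s.reg Reg.top)
    (idx := .add (.reg Reg.top) (.reg Reg.v)) (e := .get Arr.cur (.reg Reg.v))
    (f := fun i => s.arr Arr.cur i) (by
      intro i _ s' ha
      have h1 := ha.reg Reg.top (by decide)
      have h2 := ha.arr Arr.cur (by decide)
      simp only [Reg.top, Arr.cur] at h1 h2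
      simp [Expr.eval, h1, h2])
  have ha := Code.agree_den (.iter Reg.v Reg.n (.store Arr.stack (.add (.reg Reg.top) (.reg Reg.v))
      (.get Arr.cur (.reg Reg.v)))) s
  rw [push, Code.den]
  generalize Code.den (.iter Reg.v Reg.n (.store Arr.stack (.add (.reg Reg.top) (.reg Reg.v))
      (.get Arr.cur (.reg Reg.v)))) s = t at h1 h2 ha
  rw [hl.top] at h1 h2
  refine ⟨?_, fun v => ?_, hl.holds.congr h2⟩
  · simp only [Code.den, Expr.eval, State.setReg_reg, if_true, List.length_cons]
    rw [ha.reg Reg.top (by decide), ha.reg Reg.n (by decide), hl.top, hs.n_eq, add_mul, one_mul]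
  · exact (h1 v (by rw [hs.n_eq]; exact v.2)).trans (hX v)

theorem pop_spec (hs : I.Loaded s) (hl : IsStack s (X :: l)) :
    IsStack (pop.den s) l ∧ Stores (pop.den s) Arr.cur X := by
  rw [pop, Code.den]
  have htop : (Code.den (.assign Reg.top (.sub (.reg Reg.top) (.reg Reg.n))) s).reg Reg.top =
      l.length * I.n := by
    simp only [Code.den, Expr.eval, State.setReg_reg, if_true, hl.top, hs.n_eq, List.length_cons,
      add_mul, one_mul, Nat.add_sub_cancel]
  have ha := Code.agree_den (.assign Reg.top (.sub (.reg Reg.top) (.reg Reg.n))) s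
  generalize Code.den (.assign Reg.top (.sub (.reg Reg.top) (.reg Reg.n))) s = t at htop ha
  have hst := ha.arr Arr.stack (by decide)
  have h1 := (fill_spec (s := t) (a := Arr.cur) (base := 0)
    (idx := .reg Reg.v) (e := .get Arr.stack (.add (.reg Reg.top) (.reg Reg.v)))
    (f := fun i => t.arr Arr.stack (t.reg Reg.top + i)) (by
      intro i _ s' ha
      have h1 := ha.reg Reg.top (by decide)
      have h2 := ha.arr Arr.stack (by decide)
      simp only [Reg.top, Arr.stack] at h1 h2
      simp [Expr.eval, h1, h2])).1
  have ha' := Code.agree_den (.iter Reg.v Reg.n (.store Arr.cur (.reg Reg.v)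
      (.get Arr.stack (.add (.reg Reg.top) (.reg Reg.v))))) t
  refine ⟨IsStack.of_agree ⟨htop, ?_⟩ ha' (by decide) (by decide), fun v => ?_⟩
  · rw [hst]
    exact hl.holds.2
  · have := h1 v (by rw [ha.reg Reg.n (by decide), hs.n_eq]; exact v.2)
    rw [zero_add] at this
    rw [this, htop, hst]
    exact hl.holds.1 v

theorem tryPush_spec {u : Fin I.n} (hs : I.Loaded s) (hX : Stores s Arr.cur X)
    (hl : IsStack s l) (hu : s.reg Reg.u = u) (huX : u ∉ X) :
    Stores (tryPush.den s) Arr.cur X ∧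
      ((I.D.Spares I.k₂ (insert u X) ∧ IsStack (tryPush.den s) (insert u X :: l) ∧
          (tryPush.den s).reg Reg.room = s.reg Reg.room - 1) ∨
        (¬ I.D.Spares I.k₂ (insert u X) ∧ IsStack (tryPush.den s) l ∧
          (tryPush.den s).reg Reg.room = s.reg Reg.room)) := by
  classical
  rw [tryPush, Code.den_seq, Code.den_seq, Code.den_seq]
  have hs1 : I.Loaded (Code.den (.store Arr.cur (.reg Reg.u) (.lit 1)) s) :=
    hs.setArr _ _ (by simp)
  have hl1 : IsStack (Code.den (.store Arr.cur (.reg Reg.u) (.lit 1)) s) l :=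
    hl.of_agree (Code.agree_den _ _) (by decide) (by decide)
  have hX1 : Stores (Code.den (.store Arr.cur (.reg Reg.u) (.lit 1)) s) Arr.cur (insert u X) := by
    intro v
    simp only [Code.den, Expr.eval, State.setArr_arr, hu, true_and, Finset.mem_insert, hX v]
    by_cases h : v = u
    · simp [h]
    · simp [h, Fin.val_inj]
  have ha1 := Code.agree_den (.store Arr.cur (.reg Reg.u) (.lit 1)) s
  generalize Code.den (.store Arr.cur (.reg Reg.u) (.lit 1)) s = t at hs1 hl1 hX1 ha1
  have htest := testSpares_spec hs1 hX1
  have ha2 := Code.agree_den testSpares t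
  have hs2 := hs1.of_agree ha2 (by decide) (by decide)
  have hl2 := hl1.of_agree ha2 (by decide) (by decide)
  have hX2 := hX1.of_eq (ha2.arr _ (by decide))
  have hroom : (testSpares.den t).reg Reg.room = s.reg Reg.room := by
    rw [ha2.reg _ (by decide), ha1.reg _ (by decide)]
  have hu2 : (testSpares.den t).reg Reg.u = u := by
    rw [ha2.reg _ (by decide), ha1.reg _ (by decide), hu]
  generalize testSpares.den t = t2 at htest hs2 hl2 hX2 hroom hu2
  have hfinal : ∀ t3 : State, Stores t3 Arr.cur (insert u X) → t3.reg Reg.u = u →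
      Stores (Code.den (.store Arr.cur (.reg Reg.u) (.lit 0)) t3) Arr.cur X := by
    intro t3 h1 h2 v
    simp only [Code.den, Expr.eval, State.setArr_arr, h2, true_and, h1 v, Finset.mem_insert]
    by_cases h : v = u
    · simp [h, huX]
    · simp [h, Fin.val_inj]
  by_cases h : (Expr.reg Reg.test).eval t2 ≠ 0
  · rw [Code.den_cond_of_ne h, Code.den_seq]
    have hl3 := push_spec hs2 hX2 hl2
    have ha3 := Code.agree_den push t2
    refine ⟨hfinal _ ?_ ?_, Or.inl ⟨htest.1 h, ?_, ?_⟩⟩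
    · exact hX2.of_eq (ha3.arr _ (by decide))
    · rw [Code.den, State.setReg_reg, if_neg (by decide), ha3.reg _ (by decide), hu2]
    · exact hl3.of_eq rfl (by funext j; simp [Code.den])
    · simp only [Code.den, Expr.eval, State.setArr_reg, State.setReg_reg, if_true]
      rw [ha3.reg _ (by decide), hroom]
  · rw [Code.den_cond_of_eq (not_not.1 h)]
    refine ⟨hfinal _ hX2 hu2, Or.inr ⟨fun h' => h (htest.2 h'), ?_, ?_⟩⟩
    · exact hl2.of_eq rfl (by funext j; simp [Code.den])
    · simp only [Code.den, State.setArr_reg, hroom]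

/-- The final alternative is the one required by `Extends.exists_insert`. It comes from the
invariant that `us.length` plus `room` equals the limit. -/
theorem expand_spec (hs : I.Loaded s) (hX : Stores s Arr.cur X) (hl : IsStack s l) :
    ∃ us : List (Fin I.n), us.Nodup ∧ IsStack (expand.den s) (us.map (insert · X) ++ l) ∧
      us.length ≤ s.reg Reg.limit ∧ (∀ u ∈ us, I.D.IsCandidate I.k₂ X u) ∧
      ((∀ u, I.D.IsCandidate I.k₂ X u → u ∈ us) ∨ us.length = s.reg Reg.limit) := by
  classical
  rw [expand, Code.den]
  have hroom : (Code.den (.assign Reg.room (.reg Reg.limit)) s).reg Reg.room = s.reg Reg.limit := by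
    simp [Code.den, Expr.eval]
  have ha := Code.agree_den (.assign Reg.room (.reg Reg.limit)) s
  generalize Code.den (.assign Reg.room (.reg Reg.limit)) s = t at hroom ha
  have hs1 := hs.of_agree ha (by decide) (by decide)
  have hl1 := hl.of_agree ha (by decide) (by decide)
  have hX1 := hX.of_eq (ha.arr _ (by decide))
  have := Code.den_iter_induction (x := Reg.u) (b := Reg.n)
    (p := .cond (.reg Reg.room) (.cond (.get Arr.cur (.reg Reg.u)) .skip
      (.seq (findInNeighbor Arr.cur Reg.u) (.cond (.reg Reg.found) tryPush .skip))) .skip) (s := t)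
    (fun i s' => Stores s' Arr.cur X ∧ ∃ us : List (Fin I.n), us.Nodup ∧
      IsStack s' (us.map (insert · X) ++ l) ∧ us.length + s'.reg Reg.room = s.reg Reg.limit ∧
      (∀ u ∈ us, i ≤ u.val ∧ I.D.IsCandidate I.k₂ X u) ∧
      (s'.reg Reg.room ≠ 0 → ∀ u, i ≤ u.val → I.D.IsCandidate I.k₂ X u → u ∈ us)) ?_ ?_
  · obtain ⟨-, us, h1, h2, h3, h4, h5⟩ := this
    refine ⟨us, h1, h2, by omega, fun u hu => (h4 u hu).2, ?_⟩
    by_cases h : us.length = s.reg Reg.limit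
    · exact Or.inr h
    · exact Or.inl fun u => h5 (by omega) u (Nat.zero_le _)
  · refine ⟨hX1, [], List.nodup_nil, hl1.of_eq (by simp) rfl, ?_, by simp, fun _ u hu => ?_⟩
    · simpa using hroom
    · have := hs1.n_eq
      have := u.2
      omega
  · rintro i hi s' ha' ⟨hX', us, h1, h2, h3, h4, h5⟩
    rw [hs1.n_eq] at hi
    have hs' := (hs1.of_agree ha' (by decide) (by decide)).setReg (x := Reg.u) i (by simp)
    have h2' : IsStack (s'.setReg Reg.u i) (us.map (insert · X) ++ l) := h2.of_eq (by simp) rfl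
    have hX'' : Stores (s'.setReg Reg.u i) Arr.cur X := hX'
    have hroom' : (s'.setReg Reg.u i).reg Reg.room = s'.reg Reg.room := by simp
    have hu' : (s'.setReg Reg.u i).reg Reg.u = i := by simp
    rw [← hroom'] at h3 h5
    generalize s'.setReg Reg.u i = t' at *
    -- nothing is put on the stack
    have hskip : ∀ t'' : State, Stores t'' Arr.cur X → IsStack t'' (us.map (insert · X) ++ l) →
        t''.reg Reg.room = t'.reg Reg.room →
        (t'.reg Reg.room ≠ 0 → ¬ I.D.IsCandidate I.k₂ X ⟨i, hi⟩) →
        Stores t'' Arr.cur X ∧ ∃ us : List (Fin I.n), us.Nodup ∧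
          IsStack t'' (us.map (insert · X) ++ l) ∧ us.length + t''.reg Reg.room = s.reg Reg.limit ∧
          (∀ u ∈ us, i ≤ u.val ∧ I.D.IsCandidate I.k₂ X u) ∧
          (t''.reg Reg.room ≠ 0 → ∀ u, i ≤ u.val → I.D.IsCandidate I.k₂ X u → u ∈ us) := by
      intro t'' h6 h7 h8 h9
      refine ⟨h6, us, h1, h7, by rw [h8, h3], fun u hu => ⟨by have := (h4 u hu).1; omega,
        (h4 u hu).2⟩, fun h10 u hu hc => ?_⟩
      rw [h8] at h10
      rcases hu.lt_or_eq with h | h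
      · exact h5 h10 u h hc
      · have : u = ⟨i, hi⟩ := Fin.ext h.symm
        exact absurd (this ▸ hc) (h9 h10)
    have hcur := hX'' ⟨i, hi⟩
    simp only at hcur
    by_cases hr : (Expr.reg Reg.room).eval t' = 0
    · rw [Code.den_cond_of_eq hr]
      exact hskip _ hX'' h2' rfl fun h => absurd hr h
    rw [Code.den_cond_of_ne hr]
    by_cases hiX : (⟨i, hi⟩ : Fin I.n) ∈ X
    · rw [Code.den_cond_of_ne (by simp [Expr.eval, hu', hcur, hiX])]
      exact hskip _ hX'' h2' rfl fun _ h => h.1 hiX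
    · rw [Code.den_cond_of_eq (by simp [Expr.eval, hu', hcur, hiX]), Code.den_seq]
      have hf := findInNeighbor_spec (x := Reg.u) (v := ⟨i, hi⟩) hs' hX'' hu' (by decide)
      have haf := Code.agree_den (findInNeighbor Arr.cur Reg.u) t'
      generalize (findInNeighbor Arr.cur Reg.u).den t' = t2 at hf haf
      have hs2 := hs'.of_agree haf (by decide) (by decide)
      have hl2 := h2'.of_agree haf (by decide) (by decide)
      have hX2 := hX''.of_eq (haf.arr _ (by decide))
      have hroom2 := haf.reg Reg.room (by decide)
      have hu2 := (haf.reg Reg.u (by decide)).trans hu'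
      by_cases hfound : (Expr.reg Reg.found).eval t2 = 0
      · rw [Code.den_cond_of_eq hfound]
        exact hskip _ hX2 hl2 hroom2 fun _ h => hf.2 h.2.1 hfound
      rw [Code.den_cond_of_ne hfound]
      obtain ⟨hX3, h | h⟩ := tryPush_spec (u := ⟨i, hi⟩) hs2 hX2 hl2 hu2 hiX
      swap
      · exact hskip _ hX3 h.2.1 (h.2.2.trans hroom2) fun _ h' => h.1 h'.2.2
      obtain ⟨h6, h7, h8⟩ := h
      refine ⟨hX3, ⟨i, hi⟩ :: us, ?_, h7, ?_, ?_, ?_⟩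
      · exact List.nodup_cons.2 ⟨fun h => by simpa using (h4 _ h).1, h1⟩
      · rw [h8, hroom2, List.length_cons]
        simp only [Expr.eval] at hr
        omega
      · intro u hu
        rcases List.mem_cons.1 hu with rfl | hu
        · exact ⟨le_rfl, hiX, hf.1 hfound, h6⟩
        · exact ⟨by have := (h4 u hu).1; omega, (h4 u hu).2⟩
      · intro _ u hu hc
        rcases hu.lt_or_eq with h | h
        · exact List.mem_cons_of_mem _ (h5 hr u h hc)
        · exact List.mem_cons.2 (Or.inl (Fin.ext h.symm))

end PartitionInput

/-! ### Roots and the invariant of the search -/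

namespace PartitionInput

open RAM

/-- Whether the vertex in register `Reg.u` may be the root. -/
@[simp] abbrev Reg.valid : ℕ := 21

/-- Test whether the vertex in register `Reg.u` may be the root. -/
def checkRoot : Code :=
  .seq (.assign Reg.valid (.lit 1)) (.seq
    (.iter Reg.v Reg.n (.store Arr.alive (.reg Reg.v) (.lit 1)))
    (.iter Reg.v Reg.n (.seq (findInNeighbor Arr.alive Reg.v) (.cond (.reg Reg.found) .skip
      (.cond (.add (.sub (.reg Reg.v) (.reg Reg.u)) (.sub (.reg Reg.u) (.reg Reg.v)))
        (.assign Reg.valid (.lit 0)) .skip)))))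

/-- Put the possible roots on the stack. -/
def pushRoots : Code :=
  .iter Reg.u Reg.n (.seq checkRoot (.cond (.reg Reg.valid) tryPush .skip))

/-- The bound on the number of children that have to be considered. -/
def branching (I : PartitionInput) : ℕ :=
  2 * (I.k₁ + I.k₂) * (I.k₁ + I.k₂) + 2 * (I.k₁ + I.k₂) + 1

variable {I : PartitionInput} {s s' : State} {l : List (Finset (Fin I.n))} {X : Finset (Fin I.n)}

/-- The sum `(v - u) + (u - v)` of truncated differences tests `v ≠ u`; `alive` is filled with ones
so that every vertex counts as an in-neighbour. -/
theorem checkRoot_spec {u : Fin I.n} (hs : I.Loaded s) (hu : s.reg Reg.u = u) :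
    (checkRoot.den s).reg Reg.valid ≠ 0 ↔ I.IsValidRoot u := by
  classical
  rw [checkRoot, Code.den_seq, Code.den_seq]
  have hv : (Code.den (.assign Reg.valid (.lit 1)) s).reg Reg.valid ≠ 0 := by
    simp [Code.den, Expr.eval]
  have ha := Code.agree_den (.assign Reg.valid (.lit 1)) s
  generalize Code.den (.assign Reg.valid (.lit 1)) s = t at hv ha
  have hs1 := hs.of_agree ha (by decide) (by decide)
  have hu1 := (ha.reg Reg.u (by decide)).trans hu
  have hA : Stores (Code.den (.iter Reg.v Reg.n (.store Arr.alive (.reg Reg.v) (.lit 1))) t)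
      Arr.alive (Finset.univ : Finset (Fin I.n)) := by
    intro v
    have := (fill_spec (s := t) (a := Arr.alive) (base := 0) (idx := .reg Reg.v)
      (e := .lit 1) (f := fun _ => 1) (fun i _ s' _ => by simp [Expr.eval])).1 v
        (by rw [hs1.n_eq]; exact v.2)
    rw [zero_add] at this
    rw [this, if_pos (Finset.mem_univ v)]
  have ha1 := Code.agree_den (.iter Reg.v Reg.n (.store Arr.alive (.reg Reg.v) (.lit 1))) t
  generalize Code.den (.iter Reg.v Reg.n (.store Arr.alive (.reg Reg.v) (.lit 1))) t = t1 at hA ha1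
  have hs2 := hs1.of_agree ha1 (by decide) (by decide)
  have hu2 := (ha1.reg Reg.u (by decide)).trans hu1
  have hv2 : t1.reg Reg.valid ≠ 0 := by rwa [ha1.reg Reg.valid (by decide)]
  have := Code.den_iter_induction (x := Reg.v) (b := Reg.n)
    (p := .seq (findInNeighbor Arr.alive Reg.v) (.cond (.reg Reg.found) .skip
      (.cond (.add (.sub (.reg Reg.v) (.reg Reg.u)) (.sub (.reg Reg.u) (.reg Reg.v)))
        (.assign Reg.valid (.lit 0)) .skip))) (s := t1)
    (fun i s' => Stores s' Arr.alive (Finset.univ : Finset (Fin I.n)) ∧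
      (s'.reg Reg.valid ≠ 0 ↔ ∀ v : Fin I.n, i ≤ v.val → v ≠ u → ∃ w, I.D.Adj w v)) ?_ ?_
  · simpa [IsValidRoot] using this.2
  · refine ⟨hA, iff_of_true (by simpa using hv2) fun v hv => ?_⟩
    have := hs2.n_eq
    have := v.2
    omega
  · rintro i hi s' ha' ⟨hA', ih⟩
    rw [hs2.n_eq] at hi
    have hs' := (hs2.of_agree ha' (by decide) (by decide)).setReg (x := Reg.v) i (by simp)
    have hi' : (s'.setReg Reg.v i).reg Reg.v = i := by simp
    have hA'' : Stores (s'.setReg Reg.v i) Arr.alive (Finset.univ : Finset (Fin I.n)) := hA'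
    have hu' : (s'.setReg Reg.v i).reg Reg.u = u := by
      have := (ha'.reg Reg.u (by decide)).trans hu2
      simpa using this
    have hval : (s'.setReg Reg.v i).reg Reg.valid = s'.reg Reg.valid := by simp
    rw [← hval] at ih
    generalize s'.setReg Reg.v i = t' at *
    have hf := findInNeighbor_spec (v := ⟨i, hi⟩) (x := Reg.v) hs' hA'' hi' (by decide)
    rw [Code.den_seq]
    have haf := Code.agree_den (findInNeighbor Arr.alive Reg.v) t'
    generalize (findInNeighbor Arr.alive Reg.v).den t' = t2 at hf haf
    have hvt := haf.reg Reg.valid (by decide)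
    have hut := (haf.reg Reg.u (by decide)).trans hu'
    have hit := (haf.reg Reg.v (by decide)).trans hi'
    have hAt := hA''.of_eq (haf.arr _ (by decide))
    have hskip : (⟨i, hi⟩ ≠ u → ∃ w, I.D.Adj w ⟨i, hi⟩) → (t2.reg Reg.valid ≠ 0 ↔
        ∀ v : Fin I.n, i ≤ v.val → v ≠ u → ∃ w, I.D.Adj w v) := by
      intro h
      rw [hvt, ih]
      refine ⟨fun h' v hv => ?_, fun h' v hv => h' v (by omega)⟩
      rcases hv.lt_or_eq with h3 | h3
      · exact h' v h3
      · have : v = ⟨i, hi⟩ := Fin.ext h3.symm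
        subst this
        exact h
    by_cases hfound : (Expr.reg Reg.found).eval t2 = 0
    · rw [Code.den_cond_of_eq hfound]
      have hno : ¬ ∃ w, I.D.Adj w ⟨i, hi⟩ := fun ⟨w, hw⟩ =>
        hf.2 ⟨w, Finset.mem_univ w, hw⟩ hfound
      by_cases hiu : i = u.val
      · rw [Code.den_cond_of_eq (by simp only [Expr.eval, hut, hit]; omega)]
        exact ⟨hAt, hskip fun h => absurd (Fin.ext hiu) h⟩
      · rw [Code.den_cond_of_ne (by simp only [Expr.eval, hut, hit]; omega)]
        refine ⟨hAt, iff_of_false (by simp [Code.den, Expr.eval]) fun h => hno ?_⟩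
        exact h ⟨i, hi⟩ le_rfl fun h' => hiu (congrArg Fin.val h')
    · rw [Code.den_cond_of_ne hfound]
      obtain ⟨w, -, hw⟩ := hf.1 hfound
      exact ⟨hAt, hskip fun _ => ⟨w, hw⟩⟩

theorem pushRoots_spec (hs : I.Loaded s) (hX : Stores s Arr.cur (∅ : Finset (Fin I.n)))
    (hl : s.reg Reg.top = 0) :
    ∃ us : List (Fin I.n), us.length ≤ I.n ∧ IsStack (pushRoots.den s) (us.map ({·})) ∧
      ∀ u, u ∈ us ↔ I.IsValidRoot u ∧ I.D.Spares I.k₂ {u} := by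
  classical
  have := Code.den_iter_induction (x := Reg.u) (b := Reg.n)
    (p := .seq checkRoot (.cond (.reg Reg.valid) tryPush .skip)) (s := s)
    (fun i s' => Stores s' Arr.cur (∅ : Finset (Fin I.n)) ∧ ∃ us : List (Fin I.n),
      i + us.length ≤ I.n ∧ IsStack s' (us.map ({·})) ∧
      ∀ u, u ∈ us ↔ i ≤ u.val ∧ I.IsValidRoot u ∧ I.D.Spares I.k₂ {u}) ?_ ?_
  · obtain ⟨-, us, h1, h2, h3⟩ := this
    exact ⟨us, by omega, h2, fun u => by simpa using h3 u⟩
  · refine ⟨hX, [], by simpa using hs.n_eq.le, ⟨by simpa using hl, trivial⟩, fun u => ?_⟩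
    refine iff_of_false List.not_mem_nil fun h => ?_
    have := hs.n_eq
    have := u.2
    omega
  · rintro i hi s' ha ⟨hX', us, h1, h2, h3⟩
    rw [hs.n_eq] at hi
    have hs' := (hs.of_agree ha (by decide) (by decide)).setReg (x := Reg.u) i (by simp)
    have hu' : (s'.setReg Reg.u i).reg Reg.u = i := by simp
    have h2' : IsStack (s'.setReg Reg.u i) (us.map ({·})) := h2.of_eq (by simp) rfl
    have hX'' : Stores (s'.setReg Reg.u i) Arr.cur (∅ : Finset (Fin I.n)) := hX'
    generalize s'.setReg Reg.u i = t at *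
    have hc := checkRoot_spec (u := ⟨i, hi⟩) hs' hu'
    have hac := Code.agree_den checkRoot t
    rw [Code.den_seq]
    generalize checkRoot.den t = t' at hc hac
    have hs2 := hs'.of_agree hac (by decide) (by decide)
    have hl2 := h2'.of_agree hac (by decide) (by decide)
    have hX2 := hX''.of_eq (hac.arr _ (by decide))
    have hu2 := (hac.reg Reg.u (by decide)).trans hu'
    have hskip : ¬ (I.IsValidRoot ⟨i, hi⟩ ∧ I.D.Spares I.k₂ {⟨i, hi⟩}) →
        ∀ u, u ∈ us ↔ i ≤ u.val ∧ I.IsValidRoot u ∧ I.D.Spares I.k₂ {u} := by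
      intro h u
      rw [h3]
      refine ⟨fun h' => ⟨by omega, h'.2⟩, fun h' => ⟨?_, h'.2⟩⟩
      rcases h'.1.lt_or_eq with h4 | h4
      · exact h4
      · have : u = ⟨i, hi⟩ := Fin.ext h4.symm
        exact absurd (this ▸ h'.2) h
    by_cases hv : (Expr.reg Reg.valid).eval t' = 0
    · rw [Code.den_cond_of_eq hv]
      exact ⟨hX2, us, by omega, hl2, hskip fun h => hc.2 h.1 hv⟩
    rw [Code.den_cond_of_ne hv]
    obtain ⟨hX3, h | h⟩ := tryPush_spec (u := ⟨i, hi⟩) hs2 hX2 hl2 hu2 (Finset.notMem_empty _)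
    swap
    · exact ⟨hX3, us, by omega, h.2.1, hskip fun h' => h.1 (by simpa using h'.2)⟩
    obtain ⟨h6, h7, -⟩ := h
    refine ⟨hX3, ⟨i, hi⟩ :: us, by rw [List.length_cons]; omega, by simpa using h7, fun u => ?_⟩
    rw [List.mem_cons, h3]
    constructor
    · rintro (rfl | h)
      · exact ⟨le_rfl, hc.1 hv, by simpa using h6⟩
      · exact ⟨by omega, h.2⟩
    · rintro ⟨h4, h5⟩
      rcases h4.lt_or_eq with h4 | h4
      · exact Or.inr ⟨h4, h5⟩
      · exact Or.inl (Fin.ext h4.symm)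

/-- A tree with a valid root. -/
def IsTree (I : PartitionInput) (r : Fin I.n) (X : Finset (Fin I.n)) : Prop :=
  I.IsValidRoot r ∧ I.D.Grown r X

/-- The amount of work that a tree on the stack may cause. -/
def work (I : PartitionInput) (X : Finset (Fin I.n)) : ℕ := (I.branching + 1) ^ (I.k₁ - X.card)

/-- The invariant of the search; `k` bounds the number of steps that are still needed. -/
structure Searching (I : PartitionInput) (k : ℕ) (s : State) : Prop where
  loaded : I.Loaded s
  limit : s.reg Reg.limit = I.branching
  sound : s.reg Reg.ans ≠ 0 → I.HasPartition
  stack : ∃ l, IsStack s l ∧ (l.map I.work).sum ≤ k ∧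
    (∀ X ∈ l, I.D.Spares I.k₂ X ∧ ∃ r, I.IsTree r X) ∧
    (I.HasPartition → s.reg Reg.ans ≠ 0 ∨
      ∃ X ∈ l, ∃ r, I.IsTree r X ∧ I.D.Extends r I.k₁ I.k₂ X)

/-- `work` is a potential: a tree gives way to at most `branching` trees with one more vertex, of
total work at most `branching * (branching + 1) ^ d < (branching + 1) ^ (d + 1)`. A tree with `k₁`
vertices has work 1 and is only removed. -/
theorem Searching.step_den {k : ℕ} (h : I.Searching k s) (htop : s.reg Reg.top ≠ 0) :
    ∃ k' < k, I.Searching k' (step.den s) := by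
  classical
  obtain ⟨hs, hlim, hsound, l, hl, hk, hgood, hcomplete⟩ := h
  cases l with
  | nil => exact absurd (by simpa using hl.top) htop
  | cons X l =>
  rw [List.map_cons, List.sum_cons] at hk
  obtain ⟨hspX, r, hr⟩ := hgood X List.mem_cons_self
  have hgood' : ∀ Y ∈ l, I.D.Spares I.k₂ Y ∧ ∃ r, I.IsTree r Y :=
    fun Y hY => hgood Y (List.mem_cons_of_mem _ hY)
  rw [step, Code.den_seq, Code.den_seq]
  obtain ⟨hl1, hX1⟩ := pop_spec hs hl
  have ha1 := Code.agree_den pop s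
  generalize pop.den s = t1 at hl1 hX1 ha1
  have hs1 := hs.of_agree ha1 (by decide) (by decide)
  have hsize := count_spec hs1 hX1
  have ha2 := Code.agree_den (count Arr.cur) t1
  generalize (count Arr.cur).den t1 = t2 at hsize ha2
  have hs2 := hs1.of_agree ha2 (by decide) (by decide)
  have hl2 := hl1.of_agree ha2 (by decide) (by decide)
  have hX2 := hX1.of_eq (ha2.arr _ (by decide))
  have hlim2 : t2.reg Reg.limit = I.branching := by
    rw [ha2.reg _ (by decide), ha1.reg _ (by decide), hlim]
  have hans2 : t2.reg Reg.ans = s.reg Reg.ans := by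
    rw [ha2.reg _ (by decide), ha1.reg _ (by decide)]
  have hwork : 1 ≤ I.work X := Nat.one_le_pow _ _ (by omega)
  by_cases hfull : I.k₁ ≤ X.card
  · rw [Code.den_cond_of_eq (by simp only [Expr.eval, hsize, hs2.k₁_eq]; omega)]
    have ha3 := Code.agree_den (.assign Reg.ans (.lit 1)) t2
    have hans3 : (Code.den (.assign Reg.ans (.lit 1)) t2).reg Reg.ans ≠ 0 := by
      simp [Code.den, Expr.eval]
    refine ⟨(l.map I.work).sum, by omega, hs2.of_agree ha3 (by decide) (by decide),
      (ha3.reg _ (by decide)).trans hlim2, fun _ => ?_, l,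
      hl2.of_agree ha3 (by decide) (by decide), le_rfl, hgood', fun _ => Or.inl hans3⟩
    exact I.hasPartition_iff.2 ⟨r, hr.1, X, by simpa using hr.2.root_mem, hr.2, hfull, hspX⟩
  · rw [Code.den_cond_of_ne (by simp only [Expr.eval, hsize, hs2.k₁_eq]; omega)]
    obtain ⟨us, hnd, hl3, hlen, hcand, hall⟩ := expand_spec hs2 hX2 hl2
    have ha3 := Code.agree_den expand t2
    rw [hlim2] at hlen hall
    have hans3 : (expand.den t2).reg Reg.ans = s.reg Reg.ans := by
      rw [ha3.reg _ (by decide), hans2]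
    have hsum : ((us.map (insert · X)).map I.work).sum < I.work X := by
      have h1 : (us.map (insert · X)).map I.work =
          us.map fun _ => (I.branching + 1) ^ (I.k₁ - X.card - 1) := by
        rw [List.map_map]
        refine List.map_congr_left fun u hu => ?_
        rw [Function.comp_apply, work, Finset.card_insert_of_notMem (hcand u hu).1]
        congr 1
      have h2 : I.work X = (I.branching + 1) ^ (I.k₁ - X.card - 1) * (I.branching + 1) := by
        rw [← pow_succ, work]
        congr 1
        omega
      have h3 : 1 ≤ (I.branching + 1) ^ (I.k₁ - X.card - 1) := Nat.one_le_pow _ _ (by omega)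
      rw [h1, h2, List.map_const', List.sum_replicate, smul_eq_mul]
      nlinarith
    -- Stated for every root: the stack stores no roots, and the one witnessing completeness may
    -- differ from the `r` at hand.
    have htree : ∀ r, I.IsTree r X → ∀ u ∈ us, I.IsTree r (insert u X) := by
      intro r hr u hu
      obtain ⟨x, hx, hxu⟩ := (hcand u hu).2.1
      exact ⟨hr.1, hr.2.grow (hcand u hu).1 hx hxu⟩
    refine ⟨_, ?_, hs2.of_agree ha3 (by decide) (by decide),
      (ha3.reg _ (by decide)).trans hlim2, by rwa [hans3], _, hl3, le_rfl, ?_, fun hP => ?_⟩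
    · rw [List.map_append, List.sum_append]
      omega
    · intro Y hY
      rcases List.mem_append.1 hY with hY | hY
      · obtain ⟨u, hu, rfl⟩ := List.mem_map.1 hY
        exact ⟨(hcand u hu).2.2, r, htree r hr u hu⟩
      · exact hgood' Y hY
    · rw [hans3]
      rcases hcomplete hP with h | ⟨Y, hY, r', hr', hext⟩
      · exact Or.inl h
      right
      rcases List.mem_cons.1 hY with rfl | hY
      · obtain ⟨u, hu, hu'⟩ := hext.exists_insert hr'.2 (by omega) (C := us.toFinset)
          (fun u hu => hcand u (List.mem_toFinset.1 hu)) (by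
            rw [List.toFinset_card_of_nodup hnd]
            exact hall.imp (fun h u hu => List.mem_toFinset.2 (h u hu)) fun h => h.ge)
        rw [List.mem_toFinset] at hu
        exact ⟨_, List.mem_append_left _ (List.mem_map_of_mem hu), r', htree r' hr' u hu, hu'⟩
      · exact ⟨Y, List.mem_append_right _ hY, r', hr', hext⟩

theorem Searching.answer {k : ℕ} (h : I.Searching k s) (htop : s.reg Reg.top = 0) :
    s.reg Reg.ans ≠ 0 ↔ I.HasPartition := by
  obtain ⟨hs, hlim, hsound, l, hl, hk, hgood, hcomplete⟩ := h
  refine ⟨hsound, fun hP => (hcomplete hP).elim id ?_⟩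
  rintro ⟨X, hX, r, -⟩
  have h1 := hl.top
  -- The top of the stack is also 0 when `n = 0`, but then there is no root `r`.
  rw [htop, eq_comm, Nat.mul_eq_zero, List.length_eq_zero_iff] at h1
  rcases h1 with rfl | h1
  · exact absurd hX List.not_mem_nil
  · exact absurd r.2 (by omega)

theorem pushRoots_searching (hs : I.Loaded s) (hX : Stores s Arr.cur (∅ : Finset (Fin I.n)))
    (htop : s.reg Reg.top = 0) (hans : s.reg Reg.ans = 0) (hlim : s.reg Reg.limit = I.branching) :
    I.Searching (I.n * (I.branching + 1) ^ I.k₁) (pushRoots.den s) := by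
  obtain ⟨us, hlen, hl, hus⟩ := pushRoots_spec hs hX htop
  have ha := Code.agree_den pushRoots s
  have hans' := (ha.reg Reg.ans (by decide)).trans hans
  refine ⟨hs.of_agree ha (by decide) (by decide), (ha.reg _ (by decide)).trans hlim,
    fun h => absurd hans' h, _, hl, ?_, ?_, fun hP => Or.inr ?_⟩
  · have h1 : ∀ x ∈ (us.map ({·})).map I.work, x ≤ (I.branching + 1) ^ I.k₁ := by
      intro x hx
      obtain ⟨X, -, rfl⟩ := List.mem_map.1 hx
      exact Nat.pow_le_pow_right (by omega) (by omega)
    refine (List.sum_le_card_nsmul _ _ h1).trans ?_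
    rw [List.length_map, List.length_map, smul_eq_mul]
    exact Nat.mul_le_mul_right _ hlen
  · intro X hX
    obtain ⟨u, hu, rfl⟩ := List.mem_map.1 hX
    exact ⟨((hus u).1 hu).2, u, ((hus u).1 hu).1, .root⟩
  · obtain ⟨r, hr, hext⟩ := I.hasPartition_iff.1 hP
    obtain ⟨Y, hY, hg, hm, hsp⟩ := hext
    exact ⟨{r}, List.mem_map_of_mem ((hus r).2 ⟨hr, hsp.mono hY⟩), r, ⟨hr, .root⟩,
      Y, hY, hg, hm, hsp⟩

end PartitionInput

/-! ### Reading the input -/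

namespace PartitionInput

open RAM

/-- The letter at the current position. -/
def curLetter : Expr := .get Arr.word (.reg Reg.pos)

/-- Add a binary digit to the number in register `x`. -/
def readDigit (x : ℕ) : Code :=
  .seq (.cond curLetter (.assign x (.add (.reg x) (.reg Reg.pow))) .skip)
    (.assign Reg.pow (.add (.reg Reg.pow) (.reg Reg.pow)))

/-- Read a letter of the input. -/
def readLetter : Code :=
  .seq (.cond (.reg Reg.phase)
    (.cond (.sub (.reg Reg.phase) (.lit 1))
      (.cond (.sub curLetter (.lit 1))
        (.seq (.assign Reg.n (.add (.reg Reg.n) (.lit 1)))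
          (.store Arr.row (.reg Reg.n) (.add (.reg Reg.pos) (.lit 1)))) .skip)
      (.cond (.sub curLetter (.lit 1))
        (.seq (.assign Reg.phase (.lit 2))
          (.store Arr.row (.lit 0) (.add (.reg Reg.pos) (.lit 1)))) (readDigit Reg.k₂)))
    (.cond (.sub curLetter (.lit 1))
      (.seq (.assign Reg.phase (.lit 1)) (.assign Reg.pow (.lit 1))) (readDigit Reg.k₁)))
  (.assign Reg.pos (.add (.reg Reg.pos) (.lit 1)))

/-- Read the input. -/
def load : Code := .seq (.assign Reg.pow (.lit 1)) (.iter Reg.i Reg.len readLetter)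

/-- Read `k` letters of the input. -/
def reading (k : ℕ) (s : State) : State := Code.iterDen readLetter.den Reg.i k s

/-- The word `l` remains to be read. -/
def Remains (s : State) (l : List (Fin 3)) : Prop :=
  ∀ j, s.arr Arr.word (s.reg Reg.pos + j) = (l.map Fin.val).getD j 0

variable {s s' : State}

theorem reading_succ (k : ℕ) (s : State) :
    reading (k + 1) s = reading k (readLetter.den (s.setReg Reg.i k)) := rfl

theorem Remains.head {a : Fin 3} {l : List (Fin 3)} (h : Remains s (a :: l)) :
    s.arr Arr.word (s.reg Reg.pos) = a := h 0

theorem Remains.tail {a : Fin 3} {l : List (Fin 3)} (h : Remains s (a :: l))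
    (h1 : s'.arr Arr.word = s.arr Arr.word) (h2 : s'.reg Reg.pos = s.reg Reg.pos + 1) :
    Remains s' l := by
  intro j
  rw [h1, h2, add_assoc, add_comm 1 j, h (j + 1)]
  rfl

theorem letter_val (b : Bool) : (letter b).val = cond b 1 0 := by cases b <;> rfl

/-- Register `pow` doubles with each digit, which gives the factor in front of `Nat.ofDigits`. The
spare count `k` allows the reading lemmas to be chained. -/
theorem reading_first (bs : List Bool) (l : List (Fin 3)) (k : ℕ) :
    ∀ s, Remains s (bs.map letter ++ l) → s.reg Reg.phase = 0 →
      ∃ s', reading (bs.length + k) s = reading k s' ∧ Remains s' l ∧ s'.reg Reg.phase = 0 ∧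
        s'.reg Reg.k₁ = s.reg Reg.k₁ +
          s.reg Reg.pow * Nat.ofDigits 2 (bs.map fun b => cond b 1 0) ∧
        s'.reg Reg.k₂ = s.reg Reg.k₂ ∧ s'.reg Reg.n = s.reg Reg.n := by
  induction bs with
  | nil => exact fun s h hp => ⟨s, by simp, by simpa using h, hp, by simp, rfl, rfl⟩
  | cons b bs ih =>
    intro s h hp
    have hh := h.head
    rw [letter_val] at hh
    simp only [Reg.phase, Reg.pos, Arr.word] at hp hh
    obtain ⟨t, ht⟩ : ∃ t, t = readLetter.den (s.setReg Reg.i (bs.length + k)) := ⟨_, rfl⟩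
    have key : Remains t (bs.map letter ++ l) ∧ t.reg Reg.phase = 0 ∧
        t.reg Reg.k₁ = s.reg Reg.k₁ + s.reg Reg.pow * cond b 1 0 ∧
        t.reg Reg.pow = s.reg Reg.pow + s.reg Reg.pow ∧
        t.reg Reg.k₂ = s.reg Reg.k₂ ∧ t.reg Reg.n = s.reg Reg.n := by
      subst ht
      refine ⟨h.tail ?_ ?_, ?_, ?_, ?_, ?_, ?_⟩
      all_goals cases b <;> simp [readLetter, readDigit, curLetter, Code.den, Expr.eval, hp, hh]
    obtain ⟨g1, g2, g3, g4, g5, g6⟩ := key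
    obtain ⟨s', h1, h2, h3, h4, h5, h6⟩ := ih t g1 g2
    refine ⟨s', ?_, h2, h3, ?_, h5.trans g5, h6.trans g6⟩
    · rw [← h1, ht, ← reading_succ]
      congr 1
      rw [List.length_cons]
      omega
    · rw [h4, g3, g4, List.map_cons, Nat.ofDigits_cons]
      ring

theorem reading_second (bs : List Bool) (l : List (Fin 3)) (k : ℕ) :
    ∀ s, Remains s (bs.map letter ++ l) → s.reg Reg.phase = 1 →
      ∃ s', reading (bs.length + k) s = reading k s' ∧ Remains s' l ∧ s'.reg Reg.phase = 1 ∧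
        s'.reg Reg.k₂ = s.reg Reg.k₂ +
          s.reg Reg.pow * Nat.ofDigits 2 (bs.map fun b => cond b 1 0) ∧
        s'.reg Reg.k₁ = s.reg Reg.k₁ ∧ s'.reg Reg.n = s.reg Reg.n := by
  induction bs with
  | nil => exact fun s h hp => ⟨s, by simp, by simpa using h, hp, by simp, rfl, rfl⟩
  | cons b bs ih =>
    intro s h hp
    have hh := h.head
    rw [letter_val] at hh
    simp only [Reg.phase, Reg.pos, Arr.word] at hp hh
    obtain ⟨t, ht⟩ : ∃ t, t = readLetter.den (s.setReg Reg.i (bs.length + k)) := ⟨_, rfl⟩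
    have key : Remains t (bs.map letter ++ l) ∧ t.reg Reg.phase = 1 ∧
        t.reg Reg.k₂ = s.reg Reg.k₂ + s.reg Reg.pow * cond b 1 0 ∧
        t.reg Reg.pow = s.reg Reg.pow + s.reg Reg.pow ∧
        t.reg Reg.k₁ = s.reg Reg.k₁ ∧ t.reg Reg.n = s.reg Reg.n := by
      subst ht
      refine ⟨h.tail ?_ ?_, ?_, ?_, ?_, ?_, ?_⟩
      all_goals cases b <;> simp [readLetter, readDigit, curLetter, Code.den, Expr.eval, hp, hh]
    obtain ⟨g1, g2, g3, g4, g5, g6⟩ := key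
    obtain ⟨s', h1, h2, h3, h4, h5, h6⟩ := ih t g1 g2
    refine ⟨s', ?_, h2, h3, ?_, h5.trans g5, h6.trans g6⟩
    · rw [← h1, ht, ← reading_succ]
      congr 1
      rw [List.length_cons]
      omega
    · rw [h4, g3, g4, List.map_cons, Nat.ofDigits_cons]
      ring

theorem reading_row (bs : List Bool) (l : List (Fin 3)) (k : ℕ) :
    ∀ s, Remains s (bs.map letter ++ l) → s.reg Reg.phase = 2 →
      ∃ s', reading (bs.length + k) s = reading k s' ∧ Remains s' l ∧ s'.reg Reg.phase = 2 ∧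
        s'.reg Reg.k₁ = s.reg Reg.k₁ ∧ s'.reg Reg.k₂ = s.reg Reg.k₂ ∧
        s'.reg Reg.n = s.reg Reg.n ∧ s'.arr = s.arr := by
  induction bs with
  | nil => exact fun s h hp => ⟨s, by simp, by simpa using h, hp, rfl, rfl, rfl, rfl⟩
  | cons b bs ih =>
    intro s h hp
    have hh := h.head
    rw [letter_val] at hh
    simp only [Reg.phase, Reg.pos, Arr.word] at hp hh
    obtain ⟨t, ht⟩ : ∃ t, t = readLetter.den (s.setReg Reg.i (bs.length + k)) := ⟨_, rfl⟩
    have key : Remains t (bs.map letter ++ l) ∧ t.reg Reg.phase = 2 ∧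
        t.reg Reg.k₁ = s.reg Reg.k₁ ∧ t.reg Reg.k₂ = s.reg Reg.k₂ ∧
        t.reg Reg.n = s.reg Reg.n ∧ t.arr = s.arr := by
      subst ht
      refine ⟨h.tail ?_ ?_, ?_, ?_, ?_, ?_, ?_⟩
      all_goals cases b <;> simp [readLetter, readDigit, curLetter, Code.den, Expr.eval, hp, hh]
    obtain ⟨g1, g2, g3, g4, g5, g6⟩ := key
    obtain ⟨s', h1, h2, h3, h4, h5, h6, h7⟩ := ih t g1 g2
    refine ⟨s', ?_, h2, h3, h4.trans g3, h5.trans g4, h6.trans g5, h7.trans g6⟩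
    rw [← h1, ht, ← reading_succ]
    congr 1
    rw [List.length_cons]
    omega

/-- At the start of a row, `n` counts the completed rows and cell `n` of `row` holds the current
position. So the number of vertices emerges only at the end of the word. -/
theorem reading_rows (R : List (List Bool)) :
    ∀ s, Remains s (R.flatMap fun bs => bs.map letter ++ [2]) → s.reg Reg.phase = 2 →
      s.arr Arr.row (s.reg Reg.n) = s.reg Reg.pos →
      ∃ s', reading (R.flatMap fun bs => bs.map letter ++ [2]).length s = s' ∧
        s'.reg Reg.k₁ = s.reg Reg.k₁ ∧ s'.reg Reg.k₂ = s.reg Reg.k₂ ∧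
        s'.reg Reg.n = s.reg Reg.n + R.length ∧ s'.arr Arr.word = s.arr Arr.word ∧
        (∀ j ≤ s.reg Reg.n, s'.arr Arr.row j = s.arr Arr.row j) ∧
        ∀ i (hi : i < R.length) v (hv : v < (R[i]).length),
          s'.arr Arr.word (s'.arr Arr.row (s.reg Reg.n + i) + v) = cond (R[i])[v] 1 0 := by
  induction R with
  | nil =>
    intro s _ _ _
    exact ⟨s, by simp [reading, Code.iterDen], rfl, rfl, rfl, rfl, fun _ _ => rfl,
      fun i hi => absurd hi (Nat.not_lt_zero i)⟩
  | cons bs R ih =>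
    intro s h hp hrow
    rw [List.flatMap_cons, List.append_assoc] at h
    obtain ⟨s1, h1, h2, h3, h4, h5, h6, h7⟩ := reading_row bs _
      ((R.flatMap fun bs => bs.map letter ++ [2]).length + 1) s h hp
    have hh : s1.arr Arr.word (s1.reg Reg.pos) = 2 := h2.head
    simp only [Reg.phase, Reg.pos, Arr.word] at h3 hh
    have key : ∀ s2, s2 = readLetter.den (s1.setReg Reg.i
        (R.flatMap fun bs => bs.map letter ++ [2]).length) →
        s2.reg Reg.phase = 2 ∧ s2.reg Reg.k₁ = s1.reg Reg.k₁ ∧ s2.reg Reg.k₂ = s1.reg Reg.k₂ ∧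
        s2.reg Reg.n = s1.reg Reg.n + 1 ∧ s2.reg Reg.pos = s1.reg Reg.pos + 1 ∧
        s2.arr Arr.word = s1.arr Arr.word ∧ s2.arr Arr.row (s2.reg Reg.n) = s2.reg Reg.pos ∧
        ∀ j ≤ s1.reg Reg.n, s2.arr Arr.row j = s1.arr Arr.row j := by
      rintro s2 rfl
      have h8 : (readLetter.den (s1.setReg Reg.i
          (R.flatMap fun bs => bs.map letter ++ [2]).length)).arr Arr.word = s1.arr Arr.word :=
        (Code.agree_den readLetter _).arr _ (by decide)
      refine ⟨?_, ?_, ?_, ?_, ?_, h8, ?_, fun j hj => ?_⟩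
      all_goals simp [readLetter, curLetter, Code.den, Expr.eval, h3, hh]
      intro h
      simp only [Reg.n] at hj
      omega
    obtain ⟨g1, g2, g3, g4, g5, g6, g7, g8⟩ := key _ rfl
    obtain ⟨s', f1, f2, f3, f4, f5, f6, f7⟩ := ih _ (h2.tail g6 g5) g1 g7
    have hrow' : ∀ j ≤ s.reg Reg.n, s'.arr Arr.row j = s.arr Arr.row j := by
      intro j hj
      rw [f6 j (by omega), g8 j (by omega), h7]
    refine ⟨s', ?_, by rw [f2, g2, h4], by rw [f3, g3, h5], ?_, by rw [f5, g6, h7], hrow', ?_⟩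
    · rw [← f1, ← reading_succ, ← h1, List.flatMap_cons, List.length_append, List.length_append,
        List.length_map]
      congr 1
      simp only [List.length_singleton]
      omega
    · rw [f4, g4, h6, List.length_cons]
      omega
    · intro i hi v hv
      cases i with
      | zero =>
        have hv' : v < bs.length := hv
        rw [add_zero, hrow' _ le_rfl, hrow, f5, g6, h7, h v]
        simp [List.getD_eq_getElem?_getD, List.getElem?_append, hv', letter_val]
      | succ i =>
        have := f7 i (by simpa using hi) v hv
        rw [g4, h6] at this
        rw [show s.reg Reg.n + (i + 1) = s.reg Reg.n + 1 + i by omega, this]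
        rfl

theorem load_spec (I : PartitionInput) : I.Loaded (load.den (init I.encode)) := by
  classical
  set R : List (List Bool) := (List.finRange I.n).map fun u =>
    (List.finRange I.n).map fun v => decide (I.D.Adj u v) with hR
  have henc : I.encode = (Nat.bits I.k₁).map letter ++ ([2] ++ ((Nat.bits I.k₂).map letter ++
      ([2] ++ R.flatMap fun bs => bs.map letter ++ [2]))) := by
    rw [encode, hR, List.flatMap_map]
    simp only [List.map_map, List.append_assoc]
    rfl
  have hload : load.den (init I.encode) = reading I.encode.length
      (((init I.encode).setReg Reg.pow 1).setReg Reg.i I.encode.length) := rfl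
  set s0 := ((init I.encode).setReg Reg.pow 1).setReg Reg.i I.encode.length with hs0
  have h0 : Remains s0 I.encode := fun j => by simp [hs0, init]
  have hlen : I.encode.length = (Nat.bits I.k₁).length + (((Nat.bits I.k₂).length +
      ((R.flatMap fun bs => bs.map letter ++ [2]).length + 1)) + 1) := by
    rw [henc]
    simp only [List.length_append, List.length_map, List.length_singleton]
    omega
  have hdig : ∀ k, Nat.ofDigits 2 ((Nat.bits k).map fun b => cond b 1 0) = k := fun k => by
    rw [← Nat.digits_two_eq_bits, Nat.ofDigits_digits]
  rw [hload, hlen]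
  rw [henc] at h0
  obtain ⟨s1, e1, r1, p1, a1, b1, c1⟩ := reading_first _ _ (((Nat.bits I.k₂).length +
      ((R.flatMap fun bs => bs.map letter ++ [2]).length + 1)) + 1) s0 h0 (by simp [hs0, init])
  rw [e1, reading_succ]
  have hh1 : s1.arr Arr.word (s1.reg Reg.pos) = 2 := r1.head
  simp only [Reg.phase, Reg.pos, Arr.word] at p1 hh1
  have key1 : ∀ k, ∀ t, t = readLetter.den (s1.setReg Reg.i k) → t.reg Reg.phase = 1 ∧
      t.reg Reg.pow = 1 ∧ t.reg Reg.k₁ = s1.reg Reg.k₁ ∧ t.reg Reg.k₂ = s1.reg Reg.k₂ ∧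
      t.reg Reg.n = s1.reg Reg.n ∧ t.reg Reg.pos = s1.reg Reg.pos + 1 ∧
      t.arr Arr.word = s1.arr Arr.word := by
    rintro k t rfl
    refine ⟨?_, ?_, ?_, ?_, ?_, ?_, (Code.agree_den readLetter _).arr _ (by decide)⟩
    all_goals simp [readLetter, curLetter, Code.den, Expr.eval, p1, hh1]
  obtain ⟨p2, w2, a2, b2, c2, q2, m2⟩ := key1 _ _ rfl
  have r2 := r1.tail m2 q2
  generalize readLetter.den (s1.setReg Reg.i _) = s2 at *
  obtain ⟨s3, e3, r3, p3, b3, a3, c3⟩ := reading_second _ _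
    ((R.flatMap fun bs => bs.map letter ++ [2]).length + 1) s2 r2 p2
  rw [e3, reading_succ]
  have hh3 : s3.arr Arr.word (s3.reg Reg.pos) = 2 := r3.head
  simp only [Reg.phase, Reg.pos, Arr.word] at p3 hh3
  have hn3 : s3.reg Reg.n = 0 := by rw [c3, c2, c1]; simp [hs0, init]
  have key3 : ∀ k, ∀ t, t = readLetter.den (s3.setReg Reg.i k) → t.reg Reg.phase = 2 ∧
      t.reg Reg.k₁ = s3.reg Reg.k₁ ∧ t.reg Reg.k₂ = s3.reg Reg.k₂ ∧
      t.reg Reg.n = 0 ∧ t.reg Reg.pos = s3.reg Reg.pos + 1 ∧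
      t.arr Arr.word = s3.arr Arr.word ∧ t.arr Arr.row 0 = t.reg Reg.pos := by
    rintro k t rfl
    simp only [Reg.n] at hn3
    refine ⟨?_, ?_, ?_, ?_, ?_, (Code.agree_den readLetter _).arr _ (by decide), ?_⟩
    all_goals simp [readLetter, curLetter, Code.den, Expr.eval, p3, hh3, hn3]
  obtain ⟨p4, a4, b4, c4, q4, m4, w4⟩ := key3 _ _ rfl
  have r4 := r3.tail m4 q4
  generalize readLetter.den (s3.setReg Reg.i _) = s4 at *
  obtain ⟨s5, e5, a5, b5, c5, -, -, f5⟩ := reading_rows R s4 r4 p4 (by rw [c4, w4])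
  rw [e5]
  refine ⟨?_, ?_, ?_, fun u v => ?_⟩
  · rw [c5, c4, hR]
    simp
  · rw [a5, a4, a3, a2, a1, hdig]
    simp [hs0, init]
  · rw [b5, b4, b3, w2, b2, b1, hdig]
    simp [hs0, init]
  · have := f5 u (by simp [hR]) v (by simp [hR])
    rw [c4, zero_add] at this
    rw [this]
    by_cases h : I.D.Adj u v <;> simp [hR, h]

end PartitionInput

/-! ### The branching limit and the running time -/

namespace PartitionInput

open RAM

/-- Prepare the computation of the branching limit. -/
def prepareLimit : Code :=
  .seq (.assign Reg.times (.add (.reg Reg.k₁) (.reg Reg.k₂)))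
    (.seq (.assign Reg.incr (.add (.add (.reg Reg.times) (.reg Reg.times)) (.lit 2)))
      (.assign Reg.limit (.lit 1)))

/-- Compute the branching limit. -/
def computeLimit : Code :=
  .iter Reg.i Reg.times (.assign Reg.limit (.add (.reg Reg.limit) (.reg Reg.incr)))

/-- The program that solves the partition problem. -/
def solve : Prog :=
  .seq (Code.seq load prepareLimit).compile (.seq computeLimit.compile (.seq pushRoots.compile
    (.seq (.loop (.reg Reg.top) step.compile) (.assign Reg.len (.reg Reg.ans)))))

/-- Multiplication by repeated addition: with `K = k₁ + k₂` the limit becomes `1 + K(2K + 2) = 2K² +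
2K + 1`. As the demands are given in binary, `K` need not be polynomial in the input length, and
this time is charged to the parameter. -/
theorem computeLimit_spec (s : State) :
    (computeLimit.den s).reg Reg.limit =
      s.reg Reg.limit + s.reg Reg.times * s.reg Reg.incr := by
  have := Code.den_iter_induction (x := Reg.i) (b := Reg.times)
    (p := .assign Reg.limit (.add (.reg Reg.limit) (.reg Reg.incr))) (s := s)
    (fun i s' => s'.reg Reg.limit + i * s.reg Reg.incr =
      s.reg Reg.limit + s.reg Reg.times * s.reg Reg.incr) ?_ ?_
  · simpa [computeLimit] using this
  · simp
  · intro i _ s' ha ih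
    have h1 := ha.reg Reg.incr (by decide)
    rw [← ih]
    simp only [Reg.incr, Reg.limit, Reg.i] at h1 ⊢
    simp [Code.den, Expr.eval, h1]
    ring

theorem n_le_length_encode (I : PartitionInput) : I.n ≤ I.encode.length := by
  simp only [encode, List.length_append, List.length_flatMap, List.length_map,
    List.length_finRange, List.length_singleton, List.map_const', List.sum_replicate, smul_eq_mul]
  nlinarith [Nat.zero_le (I.n * I.n)]

/-- The part of the running time that depends on the parameter. -/
def overhead (p : ℕ) : ℕ := (2 * (p + p) * (p + p) + 2 * (p + p) + 1 + 1) ^ p * (p + p + 1)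

theorem computable_mul_overhead (a : ℕ) : Computable fun p => a * overhead p := by
  have hpow : Primrec₂ ((· ^ ·) : ℕ → ℕ → ℕ) := Primrec₂.unpaired'.1 Nat.Primrec.pow
  have hadd : Primrec fun p : ℕ => p + p := Primrec.nat_add.comp .id .id
  have h2 : Primrec fun p : ℕ => 2 * (p + p) := Primrec.nat_mul.comp (.const 2) hadd
  exact (Primrec.nat_mul.comp (.const a) (Primrec.nat_mul.comp (hpow.comp
    (Primrec.succ.comp (Primrec.succ.comp (Primrec.nat_add.comp
      (Primrec.nat_mul.comp h2 hadd) h2))) .id) (Primrec.succ.comp hadd))).to_comp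

theorem branching_le (I : PartitionInput) :
    I.branching ≤ 2 * (I.param + I.param) * (I.param + I.param) + 2 * (I.param + I.param) + 1 := by
  have h : I.k₁ + I.k₂ ≤ I.param + I.param :=
    Nat.add_le_add (le_max_left _ _) (le_max_right _ _)
  unfold branching
  gcongr

theorem pow_branching_le_overhead (I : PartitionInput) :
    (I.branching + 1) ^ I.k₁ ≤ overhead I.param := by
  calc (I.branching + 1) ^ I.k₁ ≤ (I.branching + 1) ^ I.param :=
        Nat.pow_le_pow_right (by omega) (le_max_left _ _)
    _ ≤ (2 * (I.param + I.param) * (I.param + I.param) + 2 * (I.param + I.param) + 1 + 1) ^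
        I.param := Nat.pow_le_pow_left (Nat.succ_le_succ I.branching_le) _
    _ ≤ overhead I.param := Nat.le_mul_of_pos_right _ (Nat.succ_pos _)

theorem le_overhead (p : ℕ) : p + p + 1 ≤ overhead p :=
  Nat.le_mul_of_pos_left _ (Nat.pow_pos (Nat.succ_pos _))

/-- The pieces are compiled separately because an iteration bound must stay fixed while its piece
runs: the input length for reading, `times` for the limit, and `n`, known only after reading, for
the search. -/
theorem exec_solve (I : PartitionInput) :
    ∃ s t, Exec solve (init I.encode) s t ∧ (s.reg 0 ≠ 0 ↔ I.HasPartition) ∧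
      t ≤ (Code.seq load prepareLimit).weight *
          (I.encode.length + 1) ^ (Code.seq load prepareLimit).depth +
        (computeLimit.weight * (I.param + I.param + 1) +
        (pushRoots.weight * (I.encode.length + 1) ^ pushRoots.depth +
        ((I.n * (I.branching + 1) ^ I.k₁ + 1) *
          (step.weight * (I.encode.length + 1) ^ step.depth + 2) + 2))) := by
  have hlen : (init I.encode).reg Reg.len = I.encode.length := rfl
  obtain ⟨t₁, e₁, ht₁⟩ := Code.exec_compile (.seq load prepareLimit) I.encode.length
    (init I.encode) (by decide) fun b hb => by
      have h : b = Reg.len ∧ b ∉ (Code.seq load prepareLimit).regs := by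
        revert b; decide
      exact ⟨h.2, by rw [h.1, hlen]⟩
  have ha₁ := Code.agree_den (.seq load prepareLimit) (init I.encode)
  have hs₁ : I.Loaded ((Code.seq load prepareLimit).den (init I.encode)) :=
    I.load_spec.of_agree (Code.agree_den prepareLimit _) (by decide) (by decide)
  have htimes : ((Code.seq load prepareLimit).den (init I.encode)).reg Reg.times =
      I.k₁ + I.k₂ := by
    rw [← I.load_spec.k₁_eq, ← I.load_spec.k₂_eq]
    simp [prepareLimit, Code.den, Expr.eval]
  have hincr : ((Code.seq load prepareLimit).den (init I.encode)).reg Reg.incr =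
      I.k₁ + I.k₂ + (I.k₁ + I.k₂) + 2 := by
    rw [← I.load_spec.k₁_eq, ← I.load_spec.k₂_eq]
    simp [prepareLimit, Code.den, Expr.eval]
  have hlimit : ((Code.seq load prepareLimit).den (init I.encode)).reg Reg.limit = 1 := by
    simp [prepareLimit, Code.den, Expr.eval]
  generalize (Code.seq load prepareLimit).den (init I.encode) = s₁ at *
  have hK : I.k₁ + I.k₂ ≤ I.param + I.param :=
    Nat.add_le_add (le_max_left _ _) (le_max_right _ _)
  obtain ⟨t₂, e₂, ht₂⟩ := Code.exec_compile computeLimit (I.param + I.param) s₁ (by decide)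
    fun b hb => by
      have h : b = Reg.times ∧ b ∉ computeLimit.regs := by
        revert b; decide
      exact ⟨h.2, by rw [h.1, htimes]; exact hK⟩
  have ha₂ := Code.agree_den computeLimit s₁
  have hs₂ := hs₁.of_agree ha₂ (by decide) (by decide)
  have hlim₂ : (computeLimit.den s₁).reg Reg.limit = I.branching := by
    rw [computeLimit_spec, htimes, hincr, hlimit, branching]
    ring
  generalize computeLimit.den s₁ = s₂ at *
  obtain ⟨t₃, e₃, ht₃⟩ := Code.exec_compile pushRoots I.encode.length s₂ (by decide)
    fun b hb => by
      have h : b = Reg.n ∧ b ∉ pushRoots.regs := by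
        revert b; decide
      exact ⟨h.2, by rw [h.1, hs₂.n_eq]; exact I.n_le_length_encode⟩
  have hinv := pushRoots_searching hs₂
    (fun v => by rw [ha₂.arr _ (by decide), ha₁.arr _ (by decide)]; simp [init])
    (by rw [ha₂.reg _ (by decide), ha₁.reg _ (by decide)]; rfl)
    (by rw [ha₂.reg _ (by decide), ha₁.reg _ (by decide)]; rfl) hlim₂
  obtain ⟨k', s₄, t₄, e₄, hinv', htop, ht₄⟩ := Code.exec_loop step (.reg Reg.top) I.Searching
    I.encode.length (by decide) (fun k s hs b hb => by
      have h : b = Reg.n ∧ b ∉ step.regs := by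
        revert b; decide
      exact ⟨h.2, by rw [h.1, hs.loaded.n_eq]; exact I.n_le_length_encode⟩)
    (fun k s hs h => hs.step_den h) _ _ hinv
  refine ⟨_, _, .seq e₁ (.seq e₂ (.seq e₃ (.seq e₄ (.assign _ _ _)))), ?_, ?_⟩
  · simpa [Expr.eval] using hinv'.answer htop
  · have hd : computeLimit.depth = 1 := rfl
    rw [hd, pow_one] at ht₂
    simp only [Expr.cost, add_assoc, Nat.reduceAdd] at ht₄
    simp only [Expr.cost]
    omega

theorem exec_solve_le (I : PartitionInput) :
    ∃ s t, Exec solve (init I.encode) s t ∧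
      t ≤ ((Code.seq load prepareLimit).weight + computeLimit.weight + pushRoots.weight +
          step.weight + 4) * overhead I.param * (I.encode.length + 1) ^
            ((Code.seq load prepareLimit).depth + pushRoots.depth + (step.depth + 1)) ∧
      (s.reg 0 ≠ 0 ↔ I.HasPartition) := by
  obtain ⟨s, t, h1, h2, h3⟩ := I.exec_solve
  refine ⟨s, t, h1, ?_, h2⟩
  generalize Code.seq load prepareLimit = q at *
  have hF := I.pow_branching_le_overhead
  have hF' := le_overhead I.param
  have hn := I.n_le_length_encode
  generalize overhead I.param = F at *
  generalize I.encode.length = N at *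
  generalize (I.branching + 1) ^ I.k₁ = G at *
  set c := q.depth + pushRoots.depth + (step.depth + 1)
  have hpow : ∀ d ≤ c, (N + 1) ^ d ≤ (N + 1) ^ c := fun d hd => Nat.pow_le_pow_right (by omega) hd
  have hone : 1 ≤ (N + 1) ^ c := Nat.one_le_pow _ _ (by omega)
  have hF1 : 1 ≤ F := by omega
  have a1 : q.weight * (N + 1) ^ q.depth ≤ q.weight * F * (N + 1) ^ c :=
    Nat.mul_le_mul (Nat.le_mul_of_pos_right _ hF1) (hpow _ (by omega))
  have a2 : computeLimit.weight * (I.param + I.param + 1) ≤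
      computeLimit.weight * F * (N + 1) ^ c :=
    (Nat.mul_le_mul_left _ hF').trans (Nat.le_mul_of_pos_right _ hone)
  have a3 : pushRoots.weight * (N + 1) ^ pushRoots.depth ≤
      pushRoots.weight * F * (N + 1) ^ c :=
    Nat.mul_le_mul (Nat.le_mul_of_pos_right _ hF1) (hpow _ (by omega))
  -- The at most `n` roots account for the additional factor `N + 1`, hence for `step.depth + 1` in
  -- the exponent.
  have a4 : (I.n * G + 1) * (step.weight * (N + 1) ^ step.depth + 2) ≤
      (step.weight + 2) * F * (N + 1) ^ c := by
    have h5 : I.n * G + 1 ≤ (N + 1) * F := by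
      have := Nat.mul_le_mul hn hF
      rw [add_mul, one_mul]
      omega
    have h6 : step.weight * (N + 1) ^ step.depth + 2 ≤
        (step.weight + 2) * (N + 1) ^ step.depth := by
      have := Nat.one_le_pow step.depth (N + 1) (by omega)
      rw [add_mul]
      omega
    calc _ ≤ (N + 1) * F * ((step.weight + 2) * (N + 1) ^ step.depth) := Nat.mul_le_mul h5 h6
      _ = (step.weight + 2) * F * (N + 1) ^ (step.depth + 1) := by rw [pow_succ]; ring
      _ ≤ _ := Nat.mul_le_mul_left _ (hpow _ (by omega))
  have a5 : 2 ≤ 2 * F * (N + 1) ^ c := by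
    have := Nat.mul_le_mul hF1 hone
    rw [mul_assoc]
    omega
  have a6 : (q.weight + computeLimit.weight + pushRoots.weight + step.weight + 4) * F *
      (N + 1) ^ c = q.weight * F * (N + 1) ^ c + (computeLimit.weight * F * (N + 1) ^ c +
      (pushRoots.weight * F * (N + 1) ^ c + ((step.weight + 2) * F * (N + 1) ^ c +
      2 * F * (N + 1) ^ c))) := by ring
  refine h3.trans (le_trans ?_ a6.ge)
  exact Nat.add_le_add a1 (Nat.add_le_add a2 (Nat.add_le_add a3 (Nat.add_le_add a4 a5)))

end PartitionInput

theorem theorem5 :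
    FixedParameterTractable PartitionInput.encode PartitionInput.param
      PartitionInput.HasPartition :=
  ⟨PartitionInput.solve, _, _, PartitionInput.computable_mul_overhead _,
    PartitionInput.exec_solve_le⟩
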